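/- Let $V$ be a (Hausdorff, finite-dimensional) complex manifold, let $G$ be a complex Lie group with Lie algebra $\mathfrak g$, and let $\pi:P\to V$ be a holomorphic principal $G$-bundle: $P$ is a complex manifold with a holomorphic right action of $G$, and $\pi$ is holomorphic and admits $G$-equivariant holomorphic local trivializations. Let $U$ be a real Lie subgroup of $G$ (not necessarily closed) whose Lie algebra $\mathfrak u$ is a real form of $\mathfrak g$, i.e. $\mathfrak g=\mathfrak u\oplus i\,\mathfrak u$ as real vector spaces, and let $Q=Q(V,U)$ be a reduction of $P$ to $U$: a smooth ($C^\infty$) principal $U$-bundle over $V$ together with a smooth $U$-equivariant map $f:Q\to P$ over the identity of $V$. Then there is a unique smooth connection on $Q$, with connection form $\theta$ (a $\mathfrak u$-valued $1$-form on $Q$), such that the connection form $\omega$ of its extension to $P$, that is the $\mathfrak g$-valued smooth connection form $\omega$ on $P$ with $f^*\omega=\theta$, satisfies $P^{0,1}\omega=0$. Here $P^{0,1}\omega$ is the component of type $(0,1)$ of $\omega$ on the complex manifold $P$, namely $(P^{0,1}\omega)(v)=\tfrac12\bigl(\omega(v)+i\,\omega(Jv)\bigr)$, where $J$ is the complex structure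 on the tangent spaces of $P$. -/

import Mathlib

open scoped Manifold ContDiff
open Bundle

noncomputable section

/-- A `C^n` principal bundle `P(V, G)` over the field `𝕜`, with `G` acting on `P` on the right.
With `𝕜 = ℝ` and `n = ∞` it is a differentiable principal bundle; with `𝕜 = ℂ` and `n = ω`
it is a holomorphic principal bundle (its total space carrying the canonical complex structure).
Freeness of the action and transitivity on the fibres follow from `locally_trivial`. -/
structure PrincipalBundle {𝕜 : Type*} [NontriviallyNormedField 𝕜]
    {E : Type*} [NormedAddCommGroup E] [NormedSpace 𝕜 E]
    {F : Type*} [NormedAddCommGroup F] [NormedSpace 𝕜 F]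
    {EP : Type*} [NormedAddCommGroup EP] [NormedSpace 𝕜 EP]
    (n : WithTop ℕ∞)
    (IV : ModelWithCorners 𝕜 E E) (IG : ModelWithCorners 𝕜 F F)
    (IP : ModelWithCorners 𝕜 EP EP)
    (V : Type*) [TopologicalSpace V] [ChartedSpace E V]
    (G : Type*) [TopologicalSpace G] [ChartedSpace F G] [Group G]
    (P : Type*) [TopologicalSpace P] [ChartedSpace EP P] where
  /-- the projection -/
  proj : P → V
  /-- the right action -/
  act : P → G → P
  act_one : ∀ p, act p 1 = p
  act_mul : ∀ p g h, act p (g * h) = act (act p g) h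
  proj_act : ∀ p g, proj (act p g) = proj p
  contMDiff_proj : ContMDiff IP IV n proj
  contMDiff_act : ContMDiff (IP.prod IG) IP n (fun x : P × G => act x.1 x.2)
  /-- every point of the base lies in the domain of an equivariant `C^n` local trivialization
  with `C^n` inverse -/
  locally_trivial : ∀ x : V, ∃ e : Trivialization G proj, x ∈ e.baseSet ∧
    ContMDiffOn IP (IV.prod IG) n e e.source ∧
    ContMDiffOn (IV.prod IG) IP n e.toOpenPartialHomeomorph.symm e.target ∧
    ∀ p ∈ e.source, ∀ g, (e (act p g)).2 = (e p).2 * g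

/-- A complex manifold is a real manifold with the same charts. -/
instance isManifold_real_of_complex
    {E : Type*} [NormedAddCommGroup E] [NormedSpace ℂ E]
    {M : Type*} [TopologicalSpace M] [ChartedSpace E M] [h : IsManifold 𝓘(ℂ, E) ω M] :
    IsManifold 𝓘(ℝ, E) ∞ M := by
  apply isManifold_of_contDiffOn
  intro e e' he he'
  have h1 := (contDiffGroupoid ω 𝓘(ℂ, E)).compatible he he'
  rw [contDiffGroupoid, mem_groupoid_of_pregroupoid] at h1
  have h2 : ContDiffOn ℂ ω (e.symm ≫ₕ e') ((e.symm ≫ₕ e').source ∩ Set.range id) := h1.1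
  exact (h2.restrict_scalars ℝ).of_le le_top

section Connections

variable {F : Type*} [NormedAddCommGroup F] [NormedSpace ℝ F]
  {G : Type*} [TopologicalSpace G] [ChartedSpace F G] [Group G]
  {EP : Type*} [NormedAddCommGroup EP] [NormedSpace ℝ EP]
  {P : Type*} [TopologicalSpace P] [ChartedSpace EP P]

/-- The adjoint action of `g` on the Lie algebra: the derivative at `1` of `x ↦ g x g⁻¹`
(the target tangent space, at `g 1 g⁻¹ = 1`, is the Lie algebra). -/
def adjointMap (F : Type*) [NormedAddCommGroup F] [NormedSpace ℝ F]
    {G : Type*} [TopologicalSpace G] [ChartedSpace F G] [Group G] (g : G) :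
    GroupLieAlgebra 𝓘(ℝ, F) G →L[ℝ] GroupLieAlgebra 𝓘(ℝ, F) G :=
  mfderiv (M := G) (M' := G) 𝓘(ℝ, F) 𝓘(ℝ, F) (fun x : G => g * x * g⁻¹) (1 : G)

/-- Differential `1`-forms on the real manifold `P` (no regularity required here) with values in
the Lie algebra of `G`. -/
abbrev LieValuedForm (F : Type*) [NormedAddCommGroup F] [NormedSpace ℝ F]
    (G : Type*) [TopologicalSpace G] [ChartedSpace F G] [Group G]
    (EP : Type*) [NormedAddCommGroup EP] [NormedSpace ℝ EP]
    (P : Type*) [TopologicalSpace P] [ChartedSpace EP P] :=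
  (p : P) → TangentSpace 𝓘(ℝ, EP) p →L[ℝ] GroupLieAlgebra 𝓘(ℝ, F) G

/-- `θ` is a (smooth) connection form for the right action `act` of `G` on `P`. -/
structure IsConnectionForm [IsManifold 𝓘(ℝ, EP) ∞ P] (act : P → G → P)
    (θ : LieValuedForm F G EP P) : Prop where
  smooth : ContMDiff (M' := F) 𝓘(ℝ, EP).tangent 𝓘(ℝ, F) ∞
    (fun v : TangentBundle 𝓘(ℝ, EP) P => (θ v.1 v.2 : F))
  /-- `θ` sends the value at `p = p · 1` of the fundamental vector field of `A` to `A` -/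
  fundamental : ∀ (p : P) (A : GroupLieAlgebra 𝓘(ℝ, F) G),
    θ (act p 1) (mfderiv 𝓘(ℝ, F) 𝓘(ℝ, EP) (fun g => act p g) 1 A) = A
  /-- `R_g^* θ = Ad(g⁻¹) θ` -/
  equivariant : ∀ (g : G) (p : P) (v : TangentSpace 𝓘(ℝ, EP) p),
    θ (act p g) (mfderiv 𝓘(ℝ, EP) 𝓘(ℝ, EP) (fun p => act p g) p v) =
      adjointMap F g⁻¹ (θ p v)

end Connections

section ComplexForms

/-- The canonical almost complex structure of a complex manifold, on the real tangent space at `x`.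
Mathlib identifies the tangent space at `x` with the model space through the preferred
(holomorphic) chart at `x`, so it is the multiplication by `i` there. -/
def complexJ (E : Type*) [NormedAddCommGroup E] [NormedSpace ℂ E]
    {M : Type*} [TopologicalSpace M] [ChartedSpace E M] (x : M) :
    TangentSpace 𝓘(ℝ, E) x →L[ℝ] TangentSpace 𝓘(ℝ, E) x :=
  (Complex.I • ContinuousLinearMap.id ℝ E : E →L[ℝ] E)

/-- The component `P^{0,1} ω` of type `(0,1)` of a `1`-form `ω` on a complex manifold, with values
in the Lie algebra of a complex Lie group: `v ↦ (ω v + i ω (J v)) / 2`. -/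
def zeroOnePart {F : Type*} [NormedAddCommGroup F] [NormedSpace ℂ F]
    {G : Type*} [TopologicalSpace G] [ChartedSpace F G] [Group G]
    {EP : Type*} [NormedAddCommGroup EP] [NormedSpace ℂ EP]
    {P : Type*} [TopologicalSpace P] [ChartedSpace EP P]
    (α : LieValuedForm F G EP P) : LieValuedForm F G EP P :=
  fun p => (2⁻¹ : ℝ) • (α p + (complexJ F (1 : G)).comp ((α p).comp (complexJ EP p)))

end ComplexForms

section Reductions

variable {E : Type*} [NormedAddCommGroup E] [NormedSpace ℂ E]
  {F : Type*} [NormedAddCommGroup F] [NormedSpace ℂ F]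
  {EP : Type*} [NormedAddCommGroup EP] [NormedSpace ℂ EP]
  {EU : Type*} [NormedAddCommGroup EU] [NormedSpace ℝ EU]
  {EQ : Type*} [NormedAddCommGroup EQ] [NormedSpace ℝ EQ]
  {V : Type*} [TopologicalSpace V] [ChartedSpace E V]
  {G : Type*} [TopologicalSpace G] [ChartedSpace F G] [Group G]
  {P : Type*} [TopologicalSpace P] [ChartedSpace EP P]
  {U : Type*} [TopologicalSpace U] [ChartedSpace EU U] [Group U]
  {Q : Type*} [TopologicalSpace Q] [ChartedSpace EQ Q]

/-- The map of Lie algebras induced by a group homomorphism `ι : U → G`, i.e. its derivative at `1`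
(the target tangent space, at `ι 1 = 1`, is the Lie algebra of `G`). -/
def lieAlgebraMap (EU F : Type*) [NormedAddCommGroup EU] [NormedSpace ℝ EU]
    [NormedAddCommGroup F] [NormedSpace ℝ F]
    {U : Type*} [TopologicalSpace U] [ChartedSpace EU U] [Group U]
    {G : Type*} [TopologicalSpace G] [ChartedSpace F G] [Group G] (ι : U →* G) :
    GroupLieAlgebra 𝓘(ℝ, EU) U →L[ℝ] GroupLieAlgebra 𝓘(ℝ, F) G :=
  mfderiv (M := U) (M' := G) 𝓘(ℝ, EU) 𝓘(ℝ, F) ι (1 : U)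

/-- `ι` makes `U` a real Lie subgroup (not necessarily closed) of `G`: it is a smooth injective
homomorphism, and an immersion. -/
structure IsLieSubgroup (EU F : Type*) [NormedAddCommGroup EU] [NormedSpace ℝ EU]
    [NormedAddCommGroup F] [NormedSpace ℝ F]
    {U : Type*} [TopologicalSpace U] [ChartedSpace EU U] [Group U]
    {G : Type*} [TopologicalSpace G] [ChartedSpace F G] [Group G] (ι : U →* G) : Prop where
  smooth : ContMDiff 𝓘(ℝ, EU) 𝓘(ℝ, F) ∞ ι
  injective : Function.Injective ι
  immersive : Function.Injective (lieAlgebraMap EU F ι)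

/-- The Lie algebra `𝔲` of the Lie subgroup `U` is a real form of the Lie algebra `𝔤` of the
complex Lie group `G`: `𝔤 = 𝔲 ⊕ i 𝔲` as real vector spaces. -/
def IsRealForm (EU F : Type*) [NormedAddCommGroup EU] [NormedSpace ℝ EU]
    [NormedAddCommGroup F] [NormedSpace ℂ F]
    {U : Type*} [TopologicalSpace U] [ChartedSpace EU U] [Group U]
    {G : Type*} [TopologicalSpace G] [ChartedSpace F G] [Group G] (ι : U →* G) : Prop :=
  IsCompl (lieAlgebraMap EU F ι).range
    ((lieAlgebraMap EU F ι).range.map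
      (complexJ F (1 : G) : GroupLieAlgebra 𝓘(ℝ, F) G →ₗ[ℝ] GroupLieAlgebra 𝓘(ℝ, F) G))

/-- The smooth map `f : Q → P` over the identity of `V`, equivariant with respect to `ι : U → G`,
exhibits the differentiable principal bundle `Q(V, U)` as a real subbundle (reduction to `U`) of
the holomorphic principal bundle `P(V, G)`. When `ι` is a Lie subgroup, `f` is automatically an
injective immersion. -/
structure IsReduction (BP : PrincipalBundle ω 𝓘(ℂ, E) 𝓘(ℂ, F) 𝓘(ℂ, EP) V G P)
    (BQ : PrincipalBundle ∞ 𝓘(ℝ, E) 𝓘(ℝ, EU) 𝓘(ℝ, EQ) V U Q)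
    (ι : U →* G) (f : Q → P) : Prop where
  smooth : ContMDiff 𝓘(ℝ, EQ) 𝓘(ℝ, EP) ∞ f
  proj_eq : ∀ q, BP.proj (f q) = BQ.proj q
  equivariant : ∀ q u, f (BQ.act q u) = BP.act (f q) (ι u)

/-- The connection form `α` on `P(V, G)` is the extension of the connection form `θ` on the
subbundle `Q(V, U)`: the form `α` restricts on `Q` to `θ`, that is `f^* α = ι_* θ`.
(Such an `α` is unique, by its values on vertical vectors and its equivariance.) -/
structure IsExtension [IsManifold 𝓘(ℂ, EP) ω P]
    (BP : PrincipalBundle ω 𝓘(ℂ, E) 𝓘(ℂ, F) 𝓘(ℂ, EP) V G P)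
    (ι : U →* G) (f : Q → P) (θ : LieValuedForm EU U EQ Q) (α : LieValuedForm F G EP P) :
    Prop where
  isConnectionForm : IsConnectionForm BP.act α
  restrict : ∀ (q : Q) (v : TangentSpace 𝓘(ℝ, EQ) q),
    α (f q) (mfderiv 𝓘(ℝ, EQ) 𝓘(ℝ, EP) f q v) = lieAlgebraMap EU F ι (θ q v)

end Reductions

end

/-!
Call a connection form on `P` canonical if it is of type `(1, 0)`, that is complex linear, and
restricts on `Q` to a `𝔲`-valued form. At a point of `f(Q)` the difference of two canonical forms
takes values in `𝔲`, because it vanishes on vertical vectors and these together with the vectors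
tangent to `Q` span the tangent space; it is also complex linear, so it vanishes as `𝔲 ∩ i𝔲 = 0`.
By equivariance it vanishes everywhere. Hence canonical forms are unique over every open set of
the base, and local ones glue.

Over an open set on which `P` has a holomorphic trivialization with fibre coordinate `ψ` and `Q`
has a section `s`, every `(1, 0)`-form `γ` on the base gives the connection form
`ψ⁻¹ dψ + Ad(ψ⁻¹) π^*γ` of type `(1, 0)` on `P`. With `h = ψ ∘ f ∘ s`, its pullback by `f ∘ s` is
`h⁻¹ dh + Ad(h⁻¹) γ`. As `𝔤 = 𝔲 ⊕ i𝔲`, exactly one `(1, 0)`-form `Ad(h⁻¹) γ` makes this sum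
`𝔲`-valued, and it is given by an explicit formula in `h⁻¹ dh`.
-/

noncomputable section

open Filter Topology

section ModelDeriv

variable {𝕜 : Type*} [NontriviallyNormedField 𝕜]
  {E : Type*} [NormedAddCommGroup E] [NormedSpace 𝕜 E] {H : Type*} [TopologicalSpace H]
  {E' : Type*} [NormedAddCommGroup E'] [NormedSpace 𝕜 E'] {H' : Type*} [TopologicalSpace H']
  {E'' : Type*} [NormedAddCommGroup E''] [NormedSpace 𝕜 E''] {H'' : Type*} [TopologicalSpace H'']
  {E₃ : Type*} [NormedAddCommGroup E₃] [NormedSpace 𝕜 E₃] {H₃ : Type*} [TopologicalSpace H₃]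
  (I : ModelWithCorners 𝕜 E H) (I' : ModelWithCorners 𝕜 E' H')
  {I'' : ModelWithCorners 𝕜 E'' H''} {I₃ : ModelWithCorners 𝕜 E₃ H₃}
  {M : Type*} [TopologicalSpace M] [ChartedSpace H M]
  {M' : Type*} [TopologicalSpace M'] [ChartedSpace H' M']
  {M'' : Type*} [TopologicalSpace M''] [ChartedSpace H'' M'']
  {M₃ : Type*} [TopologicalSpace M₃] [ChartedSpace H₃ M₃]

/-- The derivative of a map of manifolds as a linear map between the model spaces, to which every
tangent space is definitionally equal. Unlike that of `mfderiv`, its type does not depend on the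
base points, which can therefore be rewritten. -/
def modelDeriv (f : M → M') (x : M) : E →L[𝕜] E' := mfderiv I I' f x

variable {I I'} {f : M → M'} {x : M}

theorem modelDeriv_congr {f g : M → M'} (h : f =ᶠ[𝓝 x] g) :
    modelDeriv I I' f x = modelDeriv I I' g x :=
  h.mfderiv_eq

theorem modelDeriv_comp_of_eq {g : M' → M''} {y : M'} (hg : MDifferentiableAt I' I'' g y)
    (hf : MDifferentiableAt I I' f x) (hy : f x = y) :
    modelDeriv I I'' (fun z => g (f z)) x = (modelDeriv I' I'' g y).comp (modelDeriv I I' f x) := by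
  subst hy
  exact mfderiv_comp x hg hf

theorem modelDeriv_comp {g : M' → M''} (hg : MDifferentiableAt I' I'' g (f x))
    (hf : MDifferentiableAt I I' f x) :
    modelDeriv I I'' (fun z => g (f z)) x =
      (modelDeriv I' I'' g (f x)).comp (modelDeriv I I' f x) :=
  modelDeriv_comp_of_eq hg hf rfl

theorem modelDeriv_id : modelDeriv I I (fun z : M => z) x = ContinuousLinearMap.id 𝕜 E :=
  mfderiv_id

theorem modelDeriv_const (y : M') : modelDeriv I I' (fun _ : M => y) x = 0 :=
  mfderiv_const

theorem modelDeriv_comp₂ {g : M → M''} {c : M' → M'' → M₃}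
    (hc : MDifferentiableAt (I'.prod I'') I₃ (fun q : M' × M'' => c q.1 q.2) (f x, g x))
    (hf : MDifferentiableAt I I' f x) (hg : MDifferentiableAt I I'' g x) (v : E) :
    modelDeriv I I₃ (fun z => c (f z) (g z)) x v =
      modelDeriv I' I₃ (fun y => c y (g x)) (f x) (modelDeriv I I' f x v) +
        modelDeriv I'' I₃ (c (f x)) (g x) (modelDeriv I I'' g x v) := by
  have hcomp : modelDeriv I I₃ (fun z => c (f z) (g z)) x v =
      modelDeriv (I'.prod I'') I₃ (fun q : M' × M'' => c q.1 q.2) (f x, g x)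
        (modelDeriv I I' f x v, modelDeriv I I'' g x v) := by
    rw [modelDeriv_comp (f := fun z => (f z, g z)) (g := fun q : M' × M'' => c q.1 q.2) hc
      (hf.prodMk hg), modelDeriv, modelDeriv, mfderiv_prodMk hf hg]
    rfl
  exact hcomp.trans (mfderiv_prod_eq_add_apply hc)

end ModelDeriv

section RestrictScalars

variable {𝕜 𝕂 : Type*} [NontriviallyNormedField 𝕜] [NontriviallyNormedField 𝕂]
  {E : Type*} [NormedAddCommGroup E] [NormedSpace 𝕜 E] [NormedSpace 𝕂 E]
  {E' : Type*} [NormedAddCommGroup E'] [NormedSpace 𝕜 E'] [NormedSpace 𝕂 E']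
  {H : Type*} [TopologicalSpace H] {H' : Type*} [TopologicalSpace H']
  {I : ModelWithCorners 𝕜 E H} {IK : ModelWithCorners 𝕂 E H}
  {I' : ModelWithCorners 𝕜 E' H'} {IK' : ModelWithCorners 𝕂 E' H'}
  {M : Type*} [TopologicalSpace M] [ChartedSpace H M]
  {M' : Type*} [TopologicalSpace M'] [ChartedSpace H' M']
  {n : WithTop ℕ∞} {f : M → M'} {s : Set M} {x : M}

theorem extChartAt_eq_of_toPartialEquiv_eq (hI : I.toPartialEquiv = IK.toPartialEquiv) (x : M) :
    extChartAt I x = extChartAt IK x := by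
  simp only [extChartAt, OpenPartialHomeomorph.extend, hI]

theorem range_eq_of_toPartialEquiv_eq (hI : I.toPartialEquiv = IK.toPartialEquiv) :
    Set.range I = Set.range IK :=
  congrArg (fun e : PartialEquiv H E => Set.range e) hI

variable [NormedAlgebra 𝕜 𝕂] [IsScalarTower 𝕜 𝕂 E] [IsScalarTower 𝕜 𝕂 E']

theorem contMDiffOn_restrictScalars (hI : I.toPartialEquiv = IK.toPartialEquiv)
    (hI' : I'.toPartialEquiv = IK'.toPartialEquiv) (hf : ContMDiffOn IK IK' n f s) :
    ContMDiffOn I I' n f s := by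
  intro x hx
  have h := contMDiffWithinAt_iff.1 (hf x hx)
  refine contMDiffWithinAt_iff.2 ⟨h.1, ?_⟩
  rw [extChartAt_eq_of_toPartialEquiv_eq hI, extChartAt_eq_of_toPartialEquiv_eq hI',
    range_eq_of_toPartialEquiv_eq hI]
  exact h.2.restrict_scalars 𝕜

theorem contMDiff_restrictScalars (hI : I.toPartialEquiv = IK.toPartialEquiv)
    (hI' : I'.toPartialEquiv = IK'.toPartialEquiv) (hf : ContMDiff IK IK' n f) :
    ContMDiff I I' n f :=
  contMDiffOn_univ.1 (contMDiffOn_restrictScalars hI hI' hf.contMDiffOn)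

theorem modelDeriv_restrictScalars (hI : I.toPartialEquiv = IK.toPartialEquiv)
    (hI' : I'.toPartialEquiv = IK'.toPartialEquiv) (hf : MDifferentiableAt IK IK' f x) :
    modelDeriv I I' f x = (modelDeriv IK IK' f x).restrictScalars 𝕜 := by
  have h := hf.hasMFDerivAt
  refine HasMFDerivAt.mfderiv (f' := (modelDeriv IK IK' f x).restrictScalars 𝕜) ⟨h.1, ?_⟩
  simp only [writtenInExtChartAt, extChartAt_eq_of_toPartialEquiv_eq hI,
    extChartAt_eq_of_toPartialEquiv_eq hI', range_eq_of_toPartialEquiv_eq hI]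
  exact HasFDerivWithinAt.restrictScalars 𝕜 h.2

theorem modelDeriv_smul_of_mdifferentiableAt (hI : I.toPartialEquiv = IK.toPartialEquiv)
    (hI' : I'.toPartialEquiv = IK'.toPartialEquiv) (hf : MDifferentiableAt IK IK' f x)
    (c : 𝕂) (v : E) : modelDeriv I I' f x (c • v) = c • modelDeriv I I' f x v := by
  rw [modelDeriv_restrictScalars hI hI' hf]
  exact (modelDeriv IK IK' f x).map_smul c v

end RestrictScalars

section TangentBundle

variable {𝕜 : Type*} [NontriviallyNormedField 𝕜]
  {E : Type*} [NormedAddCommGroup E] [NormedSpace 𝕜 E] {H : Type*} [TopologicalSpace H]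
  {E' : Type*} [NormedAddCommGroup E'] [NormedSpace 𝕜 E'] {H' : Type*} [TopologicalSpace H']
  {EN : Type*} [NormedAddCommGroup EN] [NormedSpace 𝕜 EN] {HN : Type*} [TopologicalSpace HN]
  {I : ModelWithCorners 𝕜 E H} {I' : ModelWithCorners 𝕜 E' H'} {IN : ModelWithCorners 𝕜 EN HN}
  {M : Type*} [TopologicalSpace M] [ChartedSpace H M]
  {M' : Type*} [TopologicalSpace M'] [ChartedSpace H' M']
  {N : Type*} [TopologicalSpace N] [ChartedSpace HN N]

/-- The coordinates of a tangent vector in the preferred chart at its base point. They depend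
smoothly on the vector only as long as the base point is fixed, since that chart varies with it. -/
def modelVector (v : TangentBundle I M) : E := v.2

theorem trivializationAt_tangentSpace_self [IsManifold I 1 M] (x : M) (v : TangentSpace I x) :
    (trivializationAt E (TangentSpace I) x ⟨x, v⟩).2 = v :=
  congrArg Prod.snd ((tangentBundleCore I M).localTrivAt_apply_mk x v)

variable [IsManifold I ∞ M] [IsManifold I' ∞ M']

theorem contMDiff_modelVector_of_fst_eq {k : N → TangentBundle I M}
    (hk : ContMDiff IN I.tangent ∞ k) (y : M) (hy : ∀ z, (k z).1 = y) :
    ContMDiff IN 𝓘(𝕜, E) ∞ (fun z => modelVector (k z)) := by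
  intro z
  have hfibre : ∀ a b : TangentBundle I M, a.1 = b.1 →
      (trivializationAt E (TangentSpace I) a.1 b).2 = (b.2 : E) := by
    rintro ⟨a, v⟩ ⟨b, w⟩ (rfl : a = b)
    exact trivializationAt_tangentSpace_self a w
  refine (contMDiffAt_totalSpace.1 (hk z)).2.congr_of_eventuallyEq
    (Eventually.of_forall fun t => ?_)
  exact (hfibre (k z) (k t) ((hy z).trans (hy t).symm)).symm

theorem contMDiff_tangentBundle_mk (x : M) :
    ContMDiff 𝓘(𝕜, E) I.tangent ∞ (fun v : E => (⟨x, v⟩ : TangentBundle I M)) := fun _ =>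
  contMDiffAt_totalSpace.2 ⟨contMDiffAt_const, contMDiffAt_id.congr_of_eventuallyEq
    (Eventually.of_forall fun w => trivializationAt_tangentSpace_self x w)⟩

theorem contMDiffOn_tangentMap_of_isOpen {f : M → M'} {s : Set M} (hs : IsOpen s)
    (hf : ContMDiffOn I I' ∞ f s) :
    ContMDiffOn I.tangent I'.tangent ∞
      (fun v : TangentBundle I M =>
        (⟨f v.1, modelDeriv I I' f v.1 (modelVector v)⟩ : TangentBundle I' M'))
      (TotalSpace.proj ⁻¹' s) := by
  refine (hf.contMDiffOn_tangentMapWithin (m := ∞) le_rfl hs.uniqueMDiffOn).congr fun v hv => ?_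
  simp only [tangentMapWithin, mfderivWithin_of_isOpen hs hv]
  rfl

theorem contMDiff_tangentMap_right [IsManifold IN ∞ N] {c : N → M → M'}
    (hc : ContMDiff (IN.prod I) I' ∞ (fun q : N × M => c q.1 q.2)) :
    ContMDiff (IN.prod I.tangent) I'.tangent ∞
      (fun x : N × TangentBundle I M =>
        (⟨c x.1 x.2.1, modelDeriv I I' (c x.1) x.2.1 (modelVector x.2)⟩ :
          TangentBundle I' M')) := by
  have hzero : ContMDiff (IN.prod I.tangent) IN.tangent ∞
      (fun x : N × TangentBundle I M => (⟨x.1, 0⟩ : TangentBundle IN N)) :=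
    (contMDiff_zeroSection 𝕜 (TangentSpace IN : N → Type _)).comp contMDiff_fst
  have hprod : ContMDiff (IN.prod I.tangent) (IN.prod I).tangent ∞
      (fun x : N × TangentBundle I M => (equivTangentBundleProd IN N I M).symm (⟨x.1, 0⟩, x.2)) :=
    contMDiff_equivTangentBundleProd_symm.comp (hzero.prodMk contMDiff_snd)
  refine ((hc.contMDiff_tangentMap (m := ∞) le_rfl).comp hprod).congr fun x => ?_
  have hpartial : modelDeriv (IN.prod I) I' (fun q : N × M => c q.1 q.2) (x.1, x.2.1) (0, x.2.2) =
      modelDeriv I I' (c x.1) x.2.1 x.2.2 := by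
    refine (mfderiv_prod_eq_add_apply ((hc (x.1, x.2.1)).mdifferentiableAt (by simp))).trans ?_
    have hconst : modelDeriv IN I' (fun z => c z x.2.1) x.1 0 = 0 := map_zero _
    exact (congrArg (fun w : E' => w + modelDeriv I I' (c x.1) x.2.1 x.2.2) hconst).trans
      (zero_add (modelDeriv I I' (c x.1) x.2.1 x.2.2))
  exact congrArg (fun w : E' => (⟨c x.1 x.2.1, w⟩ : TangentBundle I' M')) hpartial.symm

end TangentBundle

section ComplexStructure

variable {𝕜 𝕂 : Type*} [NontriviallyNormedField 𝕜] [NontriviallyNormedField 𝕂]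
  [NormedAlgebra 𝕜 𝕂]
  {E : Type*} [NormedAddCommGroup E] [NormedSpace 𝕜 E] [NormedSpace 𝕂 E] [IsScalarTower 𝕜 𝕂 E]
  {H : Type*} [TopologicalSpace H] {I : ModelWithCorners 𝕜 E H} {IK : ModelWithCorners 𝕂 E H}
  {M : Type*} [TopologicalSpace M] [ChartedSpace H M] [IsManifold I ∞ M] [IsManifold IK 1 M]

theorem trivializationAt_tangentSpace_eq_modelDeriv {x y : M} (hy : y ∈ (chartAt H x).source)
    (w : E) : (trivializationAt E (TangentSpace I) x ⟨y, w⟩).2 =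
      modelDeriv I 𝓘(𝕜, E) (extChartAt I x) y w := by
  have hlin := (trivializationAt E (TangentSpace I) x).linearMapAt_apply (R := 𝕜) (b := y) w
  exact (hlin.trans (if_pos hy)).symm.trans
    (DFunLike.congr_fun (TangentBundle.continuousLinearMapAt_trivializationAt (I := I) hy) w)

theorem contMDiff_const_smul_tangentBundle (hI : I.toPartialEquiv = IK.toPartialEquiv) (c : 𝕂) :
    ContMDiff I.tangent I.tangent ∞
      (fun v : TangentBundle I M => (⟨v.1, c • modelVector v⟩ : TangentBundle I M)) := by
  intro v₀
  have hid := contMDiffAt_totalSpace.1 (contMDiffAt_id (I := I.tangent) (n := ∞) (x := v₀))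
  have hc : ContMDiff 𝓘(𝕜, E) 𝓘(𝕜, E) ∞ (fun w : E => c • w) :=
    (contDiff_const_smul c).contMDiff
  refine contMDiffAt_totalSpace.2 ⟨hid.1, (hc.contMDiffAt.comp v₀ hid.2).congr_of_eventuallyEq ?_⟩
  filter_upwards [((chartAt H v₀.1).open_source.preimage
    (FiberBundle.continuous_proj E (TangentSpace I))).mem_nhds (mem_chart_source H v₀.1)] with v hv
  -- the transition maps of the tangent bundle are `𝕂`-linear
  have hchart : MDifferentiableAt IK 𝓘(𝕂, E) (extChartAt I v₀.1) v.1 := by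
    rw [extChartAt_eq_of_toPartialEquiv_eq hI]
    exact mdifferentiableAt_extChartAt hv
  refine (trivializationAt_tangentSpace_eq_modelDeriv hv (c • modelVector v)).trans ?_
  rw [modelDeriv_smul_of_mdifferentiableAt hI rfl hchart]
  exact congrArg (c • ·) (trivializationAt_tangentSpace_eq_modelDeriv hv (modelVector v)).symm

end ComplexStructure

section LieGroup

variable {𝕜 : Type*} [NontriviallyNormedField 𝕜]
  {E : Type*} [NormedAddCommGroup E] [NormedSpace 𝕜 E] {H : Type*} [TopologicalSpace H]
  {E' : Type*} [NormedAddCommGroup E'] [NormedSpace 𝕜 E'] {H' : Type*} [TopologicalSpace H']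
  {F : Type*} [NormedAddCommGroup F] [NormedSpace 𝕜 F] {HG : Type*} [TopologicalSpace HG]
  {F' : Type*} [NormedAddCommGroup F'] [NormedSpace 𝕜 F'] {HU : Type*} [TopologicalSpace HU]
  (I : ModelWithCorners 𝕜 E H) {I' : ModelWithCorners 𝕜 E' H'}
  (IG : ModelWithCorners 𝕜 F HG) {IU : ModelWithCorners 𝕜 F' HU}
  {M : Type*} [TopologicalSpace M] [ChartedSpace H M]
  {M' : Type*} [TopologicalSpace M'] [ChartedSpace H' M']
  {G : Type*} [TopologicalSpace G] [ChartedSpace HG G] [Group G]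
  {U : Type*} [TopologicalSpace U] [ChartedSpace HU U] [Group U]

/-- The adjoint representation, on the model space of the Lie group. -/
def modelAd (g : G) : F →L[𝕜] F := modelDeriv IG IG (fun x : G => g * x * g⁻¹) 1

/-- The left logarithmic derivative `f⁻¹ df` of a map into a Lie group, that is, the pullback by
`f` of the Maurer–Cartan form. -/
def leftLogDeriv (f : M → G) (x : M) : E →L[𝕜] F := modelDeriv I IG (fun y => (f x)⁻¹ * f y) x

variable {I IG} {f a b : M → G} {x : M}

theorem leftLogDeriv_congr (h : a =ᶠ[𝓝 x] b) : leftLogDeriv I IG a x = leftLogDeriv I IG b x :=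
  modelDeriv_congr <| by filter_upwards [h] with z hz using by rw [hz, h.self_of_nhds]

theorem leftLogDeriv_const (g : G) : leftLogDeriv I IG (fun _ : M => g) x = 0 :=
  modelDeriv_const _

theorem leftLogDeriv_id_one :
    leftLogDeriv IG IG (fun g : G => g) 1 = ContinuousLinearMap.id 𝕜 F := by
  simpa only [leftLogDeriv, inv_one, one_mul] using modelDeriv_id

theorem modelAd_one : modelAd IG (1 : G) = ContinuousLinearMap.id 𝕜 F := by
  simpa only [modelAd, one_mul, inv_one, mul_one] using modelDeriv_id

section

variable [LieGroup IG 1 G]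

theorem mdifferentiableAt_conj (g x : G) : MDifferentiableAt IG IG (fun y => g * y * g⁻¹) x :=
  MDifferentiableAt.comp x (mdifferentiableAt_mul_right (a := g⁻¹)) mdifferentiableAt_mul_left

theorem modelAd_mul (g h : G) : modelAd IG (g * h) = (modelAd IG g).comp (modelAd IG h) := by
  refine .trans ?_ (modelDeriv_comp_of_eq (mdifferentiableAt_conj g 1) (mdifferentiableAt_conj h 1)
    (by simp))
  simp only [modelAd, mul_inv_rev, mul_assoc]

theorem mdifferentiableAt_inv_mul (hf : MDifferentiableAt I IG f x) (g : G) :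
    MDifferentiableAt I IG (fun y => g⁻¹ * f y) x :=
  mdifferentiableAt_mul_left.comp x hf

theorem leftLogDeriv_comp {f : M' → G} {g : M → M'} (hf : MDifferentiableAt I' IG f (g x))
    (hg : MDifferentiableAt I I' g x) :
    leftLogDeriv I IG (fun z => f (g z)) x =
      (leftLogDeriv I' IG f (g x)).comp (modelDeriv I I' g x) :=
  modelDeriv_comp (mdifferentiableAt_inv_mul hf (f (g x))) hg

theorem leftLogDeriv_mul (ha : MDifferentiableAt I IG a x) (hb : MDifferentiableAt I IG b x)
    (v : E) : leftLogDeriv I IG (fun z => a z * b z) x v =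
      leftLogDeriv I IG b x v + modelAd IG (b x)⁻¹ (leftLogDeriv I IG a x v) := by
  let c : G → G → G := fun s t => (b x)⁻¹ * s * b x * t
  have hc : MDifferentiableAt (IG.prod IG) IG (fun q : G × G => c q.1 q.2)
      ((a x)⁻¹ * a x, (b x)⁻¹ * b x) :=
    (((contMDiff_const.mul contMDiff_fst).mul contMDiff_const).mul
      contMDiff_snd : ContMDiff _ _ 1 _).mdifferentiableAt one_ne_zero
  have hfactor : (fun z => (a x * b x)⁻¹ * (a z * b z)) =
      fun z => c ((a x)⁻¹ * a z) ((b x)⁻¹ * b z) := by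
    funext z
    simp only [c]
    group
  rw [leftLogDeriv, hfactor, modelDeriv_comp₂ hc (mdifferentiableAt_inv_mul ha _)
    (mdifferentiableAt_inv_mul hb _), add_comm]
  simp only [c, inv_mul_cancel, mul_one, one_mul, modelDeriv_id]
  simp only [modelAd, leftLogDeriv, inv_inv, ContinuousLinearMap.id_apply]

end

section Map

variable [LieGroup IU 1 U] {ι : U →* G}

theorem leftLogDeriv_map {a : M → U} (hι : MDifferentiableAt IU IG ι 1)
    (ha : MDifferentiableAt I IU a x) :
    leftLogDeriv I IG (fun z => ι (a z)) x =
      (modelDeriv IU IG ι 1).comp (leftLogDeriv I IU a x) := by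
  refine .trans ?_ (modelDeriv_comp_of_eq hι (mdifferentiableAt_inv_mul ha (a x))
    (inv_mul_cancel _))
  simp only [leftLogDeriv, map_mul, map_inv]

theorem modelAd_map [LieGroup IG 1 G] (hι : MDifferentiableAt IU IG ι 1) (u : U) :
    (modelAd IG (ι u)).comp (modelDeriv IU IG ι 1) =
      (modelDeriv IU IG ι 1).comp (modelAd IU u) := by
  rw [modelAd, modelAd, ← modelDeriv_comp_of_eq (mdifferentiableAt_conj (ι u) 1) hι (map_one ι),
    ← modelDeriv_comp_of_eq hι (mdifferentiableAt_conj u 1) (by simp)]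
  simp only [map_mul, map_inv]

end Map

section Smooth

variable [LieGroup IG ∞ G]

theorem contMDiffOn_leftLogDeriv [IsManifold I ∞ M] {s : Set M} (hs : IsOpen s)
    (hf : ContMDiffOn I IG ∞ f s) :
    ContMDiffOn I.tangent 𝓘(𝕜, F) ∞
      (fun v : TangentBundle I M => leftLogDeriv I IG f v.1 (modelVector v))
      (TotalSpace.proj ⁻¹' s) := by
  have hc : ContMDiff (IG.prod IG) IG ∞ (fun q : G × G => q.1⁻¹ * q.2) :=
    contMDiff_fst.inv.mul contMDiff_snd
  have hmaurerCartan := (contMDiff_tangentMap_right (c := fun a b : G => a⁻¹ * b) hc).comp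
    ((contMDiff_proj (TangentSpace IG : G → Type _)).prodMk contMDiff_id)
  refine ((contMDiff_modelVector_of_fst_eq hmaurerCartan 1 fun w =>
    inv_mul_cancel _).comp_contMDiffOn (contMDiffOn_tangentMap_of_isOpen hs hf)).congr
      fun v hv => ?_
  have hfv := (hf.contMDiffAt (hs.mem_nhds hv)).mdifferentiableAt (by simp)
  exact DFunLike.congr_fun
    (modelDeriv_comp (g := fun y => (f v.1)⁻¹ * y) mdifferentiableAt_mul_left hfv) (modelVector v)

theorem contMDiff_modelAd :
    ContMDiff (IG.prod 𝓘(𝕜, F)) 𝓘(𝕜, F) ∞ (fun q : G × F => modelAd IG q.1 q.2) := by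
  have hc : ContMDiff (IG.prod IG) IG ∞ (fun q : G × G => q.1 * q.2 * q.1⁻¹) :=
    (contMDiff_fst.mul contMDiff_snd).mul contMDiff_fst.inv
  have htangent := (contMDiff_tangentMap_right (c := fun a b : G => a * b * a⁻¹) hc).comp
    (contMDiff_fst.prodMk ((contMDiff_tangentBundle_mk (1 : G)).comp contMDiff_snd))
  exact contMDiff_modelVector_of_fst_eq htangent 1 fun q => by simp

end Smooth

end LieGroup

section ComplexLieGroup

variable {𝕜 𝕂 : Type*} [NontriviallyNormedField 𝕜] [NontriviallyNormedField 𝕂]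
  [NormedAlgebra 𝕜 𝕂]
  {E : Type*} [NormedAddCommGroup E] [NormedSpace 𝕜 E] [NormedSpace 𝕂 E] [IsScalarTower 𝕜 𝕂 E]
  {F : Type*} [NormedAddCommGroup F] [NormedSpace 𝕜 F] [NormedSpace 𝕂 F] [IsScalarTower 𝕜 𝕂 F]
  {H : Type*} [TopologicalSpace H] {HG : Type*} [TopologicalSpace HG]
  {I : ModelWithCorners 𝕜 E H} {IK : ModelWithCorners 𝕂 E H}
  {IG : ModelWithCorners 𝕜 F HG} {IGK : ModelWithCorners 𝕂 F HG}
  {M : Type*} [TopologicalSpace M] [ChartedSpace H M]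
  {G : Type*} [TopologicalSpace G] [ChartedSpace HG G] [Group G] [LieGroup IGK 1 G]

theorem modelAd_smul (hG : IG.toPartialEquiv = IGK.toPartialEquiv) (g : G) (c : 𝕂) (v : F) :
    modelAd IG g (c • v) = c • modelAd IG g v :=
  modelDeriv_smul_of_mdifferentiableAt hG hG (mdifferentiableAt_conj g 1) c v

theorem leftLogDeriv_smul (hI : I.toPartialEquiv = IK.toPartialEquiv)
    (hG : IG.toPartialEquiv = IGK.toPartialEquiv) {f : M → G} {x : M}
    (hf : MDifferentiableAt IK IGK f x) (c : 𝕂) (v : E) :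
    leftLogDeriv I IG f x (c • v) = c • leftLogDeriv I IG f x v :=
  modelDeriv_smul_of_mdifferentiableAt hI hG (mdifferentiableAt_inv_mul hf (f x)) c v

end ComplexLieGroup

instance lieGroup_real_of_complex {F : Type*} [NormedAddCommGroup F] [NormedSpace ℂ F]
    {G : Type*} [TopologicalSpace G] [ChartedSpace F G] [Group G] [LieGroup 𝓘(ℂ, F) ω G] :
    LieGroup 𝓘(ℝ, F) ∞ G where
  __ := isManifold_real_of_complex (E := F) (M := G)
  contMDiff_mul := contMDiff_restrictScalars (IK := 𝓘(ℂ, F).prod 𝓘(ℂ, F)) (IK' := 𝓘(ℂ, F)) rfl rfl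
    (contMDiff_mul 𝓘(ℂ, F) ∞)
  contMDiff_inv := contMDiff_restrictScalars (IK := 𝓘(ℂ, F)) (IK' := 𝓘(ℂ, F)) rfl rfl
    (contMDiff_inv 𝓘(ℂ, F) ∞)

namespace PrincipalBundle

variable {𝕜 : Type*} [NontriviallyNormedField 𝕜]
  {E : Type*} [NormedAddCommGroup E] [NormedSpace 𝕜 E]
  {F : Type*} [NormedAddCommGroup F] [NormedSpace 𝕜 F]
  {EP : Type*} [NormedAddCommGroup EP] [NormedSpace 𝕜 EP]
  {IV : ModelWithCorners 𝕜 E E} {IG : ModelWithCorners 𝕜 F F} {IP : ModelWithCorners 𝕜 EP EP}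
  {V : Type*} [TopologicalSpace V] [ChartedSpace E V]
  {G : Type*} [TopologicalSpace G] [ChartedSpace F G] [Group G]
  {P : Type*} [TopologicalSpace P] [ChartedSpace EP P]

section Gauge

variable {n : WithTop ℕ∞} (B : PrincipalBundle n IV IG IP V G P)

/-- A gauge of a principal bundle over the open set `O`: a local section `s` together with the
fibre coordinate `ψ` of the trivialization in which `s` is constant equal to `1`. -/
structure IsGauge (O : Set V) (s : V → P) (ψ : P → G) : Prop where
  isOpen : IsOpen O
  contMDiffOn_section : ContMDiffOn IV IP n s O
  contMDiffOn_coord : ContMDiffOn IP IG n ψ (B.proj ⁻¹' O)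
  proj_section : ∀ y ∈ O, B.proj (s y) = y
  coord_act : ∀ p, B.proj p ∈ O → ∀ g, ψ (B.act p g) = ψ p * g
  act_section_coord : ∀ p, B.proj p ∈ O → B.act (s (B.proj p)) (ψ p) = p

theorem exists_isGauge (x : V) : ∃ O s ψ, x ∈ O ∧ B.IsGauge O s ψ := by
  obtain ⟨e, hx, he, he', hact⟩ := B.locally_trivial x
  have hmem : ∀ y ∈ e.baseSet, ∀ g : G, (y, g) ∈ e.target := fun y hy g => e.mem_target.2 hy
  have hsrc : e.source = B.proj ⁻¹' e.baseSet := e.source_eq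
  let s : V → P := fun y => e.toOpenPartialHomeomorph.symm (y, 1)
  have hproj : ∀ y ∈ e.baseSet, B.proj (s y) = y := fun y hy => e.proj_symm_apply (hmem y hy 1)
  have hes : ∀ y ∈ e.baseSet, e (s y) = (y, 1) := fun y hy => e.apply_symm_apply (hmem y hy 1)
  refine ⟨e.baseSet, s, fun p => (e p).2, hx, e.open_baseSet, ?_, ?_, hproj, ?_, ?_⟩
  · exact he'.comp (contMDiff_id.prodMk contMDiff_const).contMDiffOn fun y hy => hmem y hy 1
  · exact hsrc ▸ contMDiff_snd.comp_contMDiffOn he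
  · exact fun p hp => hact p (e.mem_source.2 hp)
  · intro p hp
    have hs : s (B.proj p) ∈ e.source := e.mem_source.2 ((hproj _ hp).symm ▸ hp)
    have hsact : B.act (s (B.proj p)) (e p).2 ∈ e.source :=
      e.mem_source.2 (by rwa [B.proj_act, hproj _ hp])
    refine e.injOn hsact (e.mem_source.2 hp) (show e _ = e p from Prod.ext ?_ ?_)
    · rw [e.coe_fst hsact, e.coe_fst (e.mem_source.2 hp), B.proj_act, hproj _ hp]
    · rw [hact _ hs, hes _ hp, one_mul]

theorem surjective_proj : Function.Surjective B.proj := fun x =>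
  let ⟨_, s, _, hx, hg⟩ := B.exists_isGauge x
  ⟨s x, hg.proj_section x hx⟩

theorem act_act_inv (p : P) (g : G) : B.act (B.act p g) g⁻¹ = p := by
  rw [← B.act_mul, mul_inv_cancel, B.act_one]

theorem act_inv_act (p : P) (g : G) : B.act (B.act p g⁻¹) g = p := by
  simpa only [inv_inv] using B.act_act_inv p g⁻¹

variable {B} in
theorem IsGauge.act_inv_coord {O : Set V} {s : V → P} {ψ : P → G} (hg : B.IsGauge O s ψ) {p : P}
    (hp : B.proj p ∈ O) : B.act p (ψ p)⁻¹ = s (B.proj p) := by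
  have hcancel := B.act_act_inv (s (B.proj p)) (ψ p)
  rwa [hg.act_section_coord p hp] at hcancel

variable {B} in
theorem IsGauge.mono {O O' : Set V} {s : V → P} {ψ : P → G} (hg : B.IsGauge O s ψ)
    (hO' : IsOpen O') (h : O' ⊆ O) : B.IsGauge O' s ψ where
  isOpen := hO'
  contMDiffOn_section := hg.contMDiffOn_section.mono h
  contMDiffOn_coord := hg.contMDiffOn_coord.mono fun _ hp => h hp
  proj_section y hy := hg.proj_section y (h hy)
  coord_act p hp := hg.coord_act p (h hp)
  act_section_coord p hp := hg.act_section_coord p (h hp)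

theorem exists_act_eq {p p' : P} (h : B.proj p = B.proj p') : ∃ g, B.act p g = p' := by
  obtain ⟨O, s, ψ, hp, hg⟩ := B.exists_isGauge (B.proj p)
  have hp' := hg.act_section_coord p' (h ▸ hp)
  refine ⟨(ψ p)⁻¹ * ψ p', ?_⟩
  rw [B.act_mul, hg.act_inv_coord hp, h, hp']

end Gauge

section Smooth

variable (B : PrincipalBundle ∞ IV IG IP V G P)

theorem isOpen_preimage_proj {O : Set V} (hO : IsOpen O) : IsOpen (B.proj ⁻¹' O) :=
  hO.preimage B.contMDiff_proj.continuous

theorem mdifferentiableAt_proj (p : P) : MDifferentiableAt IP IV B.proj p :=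
  B.contMDiff_proj.mdifferentiableAt (by simp)

theorem mdifferentiableAt_act (p : P) (g : G) :
    MDifferentiableAt (IP.prod IG) IP (fun x : P × G => B.act x.1 x.2) (p, g) :=
  B.contMDiff_act.mdifferentiableAt (by simp)

theorem mdifferentiableAt_act_left (p : P) (g : G) : MDifferentiableAt IG IP (B.act p) g :=
  MDifferentiableAt.comp (f := fun g : G => (p, g)) g (B.mdifferentiableAt_act p g)
    (mdifferentiableAt_const.prodMk mdifferentiableAt_id)

theorem mdifferentiableAt_act_right (p : P) (g : G) :
    MDifferentiableAt IP IP (fun p => B.act p g) p :=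
  MDifferentiableAt.comp (f := fun p : P => (p, g)) p (B.mdifferentiableAt_act p g)
    (mdifferentiableAt_id.prodMk mdifferentiableAt_const)

theorem surjective_modelDeriv_act_right (p : P) (g : G) :
    Function.Surjective (modelDeriv IP IP (fun p => B.act p g) p) := fun w => by
  refine ⟨modelDeriv IP IP (fun p => B.act p g⁻¹) (B.act p g) w, ?_⟩
  have hcomp := modelDeriv_comp_of_eq (B.mdifferentiableAt_act_right p g)
    (B.mdifferentiableAt_act_right (B.act p g) g⁻¹) (B.act_act_inv p g)
  simp only [B.act_inv_act, modelDeriv_id] at hcomp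
  exact (DFunLike.congr_fun hcomp w).symm

section IsGauge

variable {B} {O : Set V} {s : V → P} {ψ : P → G} (hg : B.IsGauge O s ψ)

include hg

theorem IsGauge.mdifferentiableAt_section {y : V} (hy : y ∈ O) : MDifferentiableAt IV IP s y :=
  (hg.contMDiffOn_section.contMDiffAt (hg.isOpen.mem_nhds hy)).mdifferentiableAt (by simp)

theorem IsGauge.eventually_proj_mem {p : P} (hp : B.proj p ∈ O) : ∀ᶠ t in 𝓝 p, B.proj t ∈ O :=
  (B.isOpen_preimage_proj hg.isOpen).mem_nhds hp

theorem IsGauge.mdifferentiableAt_coord {p : P} (hp : B.proj p ∈ O) : MDifferentiableAt IP IG ψ p :=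
  (hg.contMDiffOn_coord.contMDiffAt (hg.eventually_proj_mem hp)).mdifferentiableAt (by simp)

end IsGauge

theorem surjective_modelDeriv_proj (p : P) :
    Function.Surjective (modelDeriv IP IV B.proj p) := fun w => by
  obtain ⟨O, s, ψ, hp, hg⟩ := B.exists_isGauge (B.proj p)
  have hds : MDifferentiableAt IV IP (fun y => B.act (s y) (ψ p)) (B.proj p) :=
    (B.mdifferentiableAt_act_right _ _).comp _ (hg.mdifferentiableAt_section hp)
  have hsection : (fun y => B.proj (B.act (s y) (ψ p))) =ᶠ[𝓝 (B.proj p)] fun y => y := by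
    filter_upwards [hg.isOpen.mem_nhds hp] with y hy
    rw [B.proj_act, hg.proj_section y hy]
  have hcomp := modelDeriv_comp_of_eq (B.mdifferentiableAt_proj p) hds (hg.act_section_coord p hp)
  rw [modelDeriv_congr hsection, modelDeriv_id] at hcomp
  exact ⟨_, (DFunLike.congr_fun hcomp w).symm⟩

theorem exists_fundamental_eq [LieGroup IG 1 G] {p : P} {v : EP}
    (hv : modelDeriv IP IV B.proj p v = 0) : ∃ A : F, modelDeriv IG IP (B.act p) 1 A = v := by
  obtain ⟨O, s, ψ, hp, hg⟩ := B.exists_isGauge (B.proj p)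
  have hds := hg.mdifferentiableAt_section hp
  have hdψ := hg.mdifferentiableAt_coord hp
  have hact : ∀ g, B.act p ((ψ p)⁻¹ * g) = B.act (s (B.proj p)) g := fun g => by
    rw [B.act_mul, hg.act_inv_coord hp]
  have hleft := modelDeriv_comp_of_eq (B.mdifferentiableAt_act_left p 1)
    (mdifferentiableAt_inv_mul hdψ (ψ p)) (inv_mul_cancel _)
  simp only [hact] at hleft
  have hsection : modelDeriv IP IP (fun t => s (B.proj t)) p v = 0 := by
    rw [modelDeriv_comp hds (B.mdifferentiableAt_proj p), ContinuousLinearMap.comp_apply, hv,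
      map_zero]
  refine ⟨leftLogDeriv IP IG ψ p v, ?_⟩
  calc modelDeriv IG IP (B.act p) 1 (leftLogDeriv IP IG ψ p v)
      = modelDeriv IG IP (B.act (s (B.proj p))) (ψ p) (modelDeriv IP IG ψ p v) :=
        (DFunLike.congr_fun (hleft.symm.trans
          (modelDeriv_comp (B.mdifferentiableAt_act_left _ _) hdψ)) v)
    _ = modelDeriv IP IP (fun t => B.act (s (B.proj t)) (ψ t)) p v := by
        rw [modelDeriv_comp₂ (f := fun t => s (B.proj t)) (B.mdifferentiableAt_act _ _)
          (hds.comp p (B.mdifferentiableAt_proj p)) hdψ, hsection, map_zero, zero_add]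
    _ = v := by
        rw [modelDeriv_congr (g := fun t => t), modelDeriv_id, ContinuousLinearMap.id_apply]
        filter_upwards [hg.eventually_proj_mem hp] with t ht using hg.act_section_coord t ht

end Smooth

section LocalConnection

variable (B : PrincipalBundle ∞ IV IG IP V G P)

/-- The form `ψ⁻¹ dψ + Ad(ψ⁻¹) π^*γ`. When `ψ` is the fibre coordinate of a gauge, it is the
connection form whose pullback by the section of the gauge is the form `γ` on the base. -/
def localConnection (ψ : P → G) (γ : V → E →L[𝕜] F) (p : P) : EP →L[𝕜] F :=
  leftLogDeriv IP IG ψ p +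
    (modelAd IG (ψ p)⁻¹).comp ((γ (B.proj p)).comp (modelDeriv IP IV B.proj p))

/-- `α` is a connection form on the part of the principal bundle that lies over `O`. -/
structure IsConnectionFormOn [IsManifold IP ∞ P] (O : Set V) (α : P → EP →L[𝕜] F) : Prop where
  contMDiffOn : ContMDiffOn IP.tangent 𝓘(𝕜, F) ∞
    (fun v : TangentBundle IP P => α v.1 (modelVector v)) (TotalSpace.proj ⁻¹' (B.proj ⁻¹' O))
  fundamental : ∀ p, B.proj p ∈ O → ∀ A, α p (modelDeriv IG IP (B.act p) 1 A) = A
  equivariant : ∀ p, B.proj p ∈ O → ∀ g v,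
    α (B.act p g) (modelDeriv IP IP (fun p => B.act p g) p v) = modelAd IG g⁻¹ (α p v)

variable {B}

theorem IsConnectionFormOn.eq_act [IsManifold IP ∞ P] {O O' : Set V} {α α' : P → EP →L[𝕜] F}
    (h : B.IsConnectionFormOn O α) (h' : B.IsConnectionFormOn O' α') {p : P}
    (hp : B.proj p ∈ O) (hp' : B.proj p ∈ O') (heq : α p = α' p) (g : G) :
    α (B.act p g) = α' (B.act p g) := by
  ext w
  obtain ⟨v, rfl⟩ := B.surjective_modelDeriv_act_right p g w
  rw [h.equivariant p hp, h'.equivariant p hp', heq]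

variable {O : Set V} {s : V → P} {ψ : P → G} {γ : V → E →L[𝕜] F}
  {EM : Type*} [NormedAddCommGroup EM] [NormedSpace 𝕜 EM] {HM : Type*} [TopologicalSpace HM]
  {IM : ModelWithCorners 𝕜 EM HM} {M : Type*} [TopologicalSpace M] [ChartedSpace HM M]

theorem localConnection_comp_of_coord_eq_mul [LieGroup IG 1 G] {f : M → P} {a b : M → G}
    {c : M → V} {x : M} (hψ : MDifferentiableAt IP IG ψ (f x)) (hf : MDifferentiableAt IM IP f x)
    (ha : MDifferentiableAt IM IG a x) (hb : MDifferentiableAt IM IG b x)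
    (hψf : (fun t => ψ (f t)) =ᶠ[𝓝 x] fun t => a t * b t)
    (hproj : ∀ t, B.proj (f t) = c t) (v : EM) :
    B.localConnection ψ γ (f x) (modelDeriv IM IP f x v) =
      leftLogDeriv IM IG b x v + modelAd IG (b x)⁻¹
        (leftLogDeriv IM IG a x v + modelAd IG (a x)⁻¹ (γ (c x) (modelDeriv IM IV c x v))) := by
  obtain rfl : (fun t => B.proj (f t)) = c := funext hproj
  have hlog : leftLogDeriv IP IG ψ (f x) (modelDeriv IM IP f x v) =
      leftLogDeriv IM IG b x v + modelAd IG (b x)⁻¹ (leftLogDeriv IM IG a x v) := by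
    rw [← leftLogDeriv_mul ha hb, ← leftLogDeriv_congr hψf, leftLogDeriv_comp hψ hf]
    rfl
  have hAd : modelAd IG (ψ (f x))⁻¹ = (modelAd IG (b x)⁻¹).comp (modelAd IG (a x)⁻¹) := by
    rw [hψf.eq_of_nhds, mul_inv_rev, modelAd_mul]
  rw [modelDeriv_comp (B.mdifferentiableAt_proj (f x)) hf, map_add, ← add_assoc, ← hlog,
    localConnection, hAd]
  rfl

theorem IsGauge.contMDiffOn_localConnection [LieGroup IG ∞ G] [IsManifold IV ∞ V]
    [IsManifold IP ∞ P] (hg : B.IsGauge O s ψ)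
    (hγ : ContMDiffOn IV.tangent 𝓘(𝕜, F) ∞
      (fun w : TangentBundle IV V => γ w.1 (modelVector w)) (TotalSpace.proj ⁻¹' O)) :
    ContMDiffOn IP.tangent 𝓘(𝕜, F) ∞
      (fun v : TangentBundle IP P => B.localConnection ψ γ v.1 (modelVector v))
      (TotalSpace.proj ⁻¹' (B.proj ⁻¹' O)) := by
  have hO := B.isOpen_preimage_proj hg.isOpen
  have hγπ := hγ.comp (contMDiffOn_tangentMap_of_isOpen hO B.contMDiff_proj.contMDiffOn)
    fun _ hv => hv
  have hπ : ContMDiff IP.tangent IP ∞ (TotalSpace.proj : TangentBundle IP P → P) :=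
    Bundle.contMDiff_proj (TangentSpace IP)
  have hψ := hg.contMDiffOn_coord.inv.comp
    (hπ.contMDiffOn (s := TotalSpace.proj ⁻¹' (B.proj ⁻¹' O))) fun _ hv => hv
  exact (contMDiffOn_leftLogDeriv hO hg.contMDiffOn_coord).add
    (contMDiff_modelAd.comp_contMDiffOn (hψ.prodMk hγπ))

theorem IsGauge.isConnectionFormOn_localConnection [LieGroup IG ∞ G] [IsManifold IV ∞ V]
    [IsManifold IP ∞ P] (hg : B.IsGauge O s ψ)
    (hγ : ContMDiffOn IV.tangent 𝓘(𝕜, F) ∞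
      (fun w : TangentBundle IV V => γ w.1 (modelVector w)) (TotalSpace.proj ⁻¹' O)) :
    B.IsConnectionFormOn O (B.localConnection ψ γ) where
  contMDiffOn := hg.contMDiffOn_localConnection hγ
  fundamental p hp A := by
    have hψ : MDifferentiableAt IP IG ψ (B.act p 1) :=
      hg.mdifferentiableAt_coord (by rwa [B.proj_act])
    have hcomp := localConnection_comp_of_coord_eq_mul (γ := γ) hψ
      (B.mdifferentiableAt_act_left p 1) (mdifferentiableAt_const (c := ψ p))
      (b := fun g => g) mdifferentiableAt_id (.of_forall (hg.coord_act p hp)) (B.proj_act p) A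
    simpa only [B.act_one, leftLogDeriv_id_one, leftLogDeriv_const, modelDeriv_const, map_zero,
      zero_apply, add_zero, ContinuousLinearMap.id_apply] using hcomp
  equivariant p hp g v := by
    have hψ : MDifferentiableAt IP IG ψ (B.act p g) :=
      hg.mdifferentiableAt_coord (by rwa [B.proj_act])
    rw [localConnection_comp_of_coord_eq_mul (f := fun p => B.act p g) hψ
      (B.mdifferentiableAt_act_right p g) (hg.mdifferentiableAt_coord hp)
      (mdifferentiableAt_const (c := g))
      (by filter_upwards [hg.eventually_proj_mem hp] with t ht using hg.coord_act t ht g)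
      (fun t => B.proj_act t g), leftLogDeriv_const]
    exact zero_add _

end LocalConnection

end PrincipalBundle

section RealForm

variable {EU : Type*} [NormedAddCommGroup EU] [NormedSpace ℝ EU]
  {E : Type*} [NormedAddCommGroup E] [NormedSpace ℂ E]
  {F : Type*} [NormedAddCommGroup F] [NormedSpace ℂ F] {L : EU →L[ℝ] F}

theorem exists_re_im_of_isCompl [CompleteSpace EU] [CompleteSpace F] (hL : Function.Injective L)
    (h : IsCompl L.range (L.range.map ((Complex.I • ContinuousLinearMap.id ℝ F : F →L[ℝ] F) :
      F →ₗ[ℝ] F))) :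
    ∃ re im : F →L[ℝ] EU, (∀ z, L (re z) + Complex.I • L (im z) = z) ∧ ∀ u, re (L u) = u := by
  let IL : EU →L[ℝ] F := (Complex.I • ContinuousLinearMap.id ℝ F : F →L[ℝ] F).comp L
  have hIL : IL.range = L.range.map
      ((Complex.I • ContinuousLinearMap.id ℝ F : F →L[ℝ] F) : F →ₗ[ℝ] F) :=
    LinearMap.range_comp L.toLinearMap _
  have hinj : Function.Injective IL := (smul_right_injective F Complex.I_ne_zero).comp hL
  have hker : (L.coprod IL).ker = ⊥ := by
    have hprod := LinearMap.ker_coprod_of_disjoint_range L.toLinearMap IL.toLinearMap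
      (hIL ▸ h.disjoint)
    rwa [LinearMap.ker_eq_bot.2 hL, LinearMap.ker_eq_bot.2 hinj, Submodule.prod_bot] at hprod
  have hrange : (L.coprod IL).range = ⊤ :=
    (LinearMap.range_coprod _ _).trans (hIL ▸ h.sup_eq_top)
  let e := ContinuousLinearEquiv.ofBijective (L.coprod IL) hker hrange
  have he : ∀ u, e (u, 0) = L u := fun u => by
    change L u + IL 0 = L u
    rw [map_zero, add_zero]
  refine ⟨(ContinuousLinearMap.fst ℝ EU EU).comp (e.symm : F →L[ℝ] EU × EU),
    (ContinuousLinearMap.snd ℝ EU EU).comp (e.symm : F →L[ℝ] EU × EU),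
    e.apply_symm_apply, fun u => ?_⟩
  rw [← he]
  exact congrArg Prod.fst (e.symm_apply_apply (u, 0))

/-- The form `-2i P^{1,0}(K β)`. When `K z ∈ 𝔲` is the imaginary part of `z = re z + i K z` in
a real form `𝔤 = 𝔲 ⊕ i𝔲`, this is the form of type `(1, 0)` whose sum with `β` is `𝔲`-valued. -/
def realFormCorrection (K : F →L[ℝ] F) (β : E →L[ℝ] F) : E →L[ℝ] F :=
  -((K.comp β).comp (Complex.I • ContinuousLinearMap.id ℝ E : E →L[ℝ] E) +
    Complex.I • K.comp β)

theorem realFormCorrection_apply (K : F →L[ℝ] F) (β : E →L[ℝ] F) (w : E) :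
    realFormCorrection K β w = -(K (β (Complex.I • w)) + Complex.I • K (β w)) :=
  rfl

theorem realFormCorrection_I_smul (K : F →L[ℝ] F) (β : E →L[ℝ] F) (w : E) :
    realFormCorrection K β (Complex.I • w) = Complex.I • realFormCorrection K β w := by
  simp only [realFormCorrection_apply, smul_neg, smul_add, smul_smul, Complex.I_mul_I,
    neg_one_smul, map_neg]
  abel

theorem add_realFormCorrection_mem_range {re im : F →L[ℝ] EU}
    (hre_im : ∀ z, L (re z) + Complex.I • L (im z) = z) (β : E →L[ℝ] F) (w : E) :
    β w + realFormCorrection (L.comp im) β w ∈ L.range := by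
  refine ⟨re (β w) - im (β (Complex.I • w)), ?_⟩
  calc L (re (β w) - im (β (Complex.I • w)))
      = (L (re (β w)) + Complex.I • L (im (β w))) +
          realFormCorrection (L.comp im) β w := by
        rw [map_sub, realFormCorrection_apply, ContinuousLinearMap.comp_apply,
          ContinuousLinearMap.comp_apply]
        abel
    _ = β w + realFormCorrection (L.comp im) β w := by rw [hre_im]

theorem contMDiffOn_realFormCorrection {V : Type*} [TopologicalSpace V] [ChartedSpace E V]
    [IsManifold 𝓘(ℂ, E) ω V] (K : F →L[ℝ] F) {β : V → E →L[ℝ] F} {O : Set V}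
    (hβ : ContMDiffOn 𝓘(ℝ, E).tangent 𝓘(ℝ, F) ∞
      (fun w : TangentBundle 𝓘(ℝ, E) V => β w.1 (modelVector w)) (TotalSpace.proj ⁻¹' O)) :
    ContMDiffOn 𝓘(ℝ, E).tangent 𝓘(ℝ, F) ∞
      (fun w : TangentBundle 𝓘(ℝ, E) V => realFormCorrection K (β w.1) (modelVector w))
      (TotalSpace.proj ⁻¹' O) := by
  have : IsManifold 𝓘(ℂ, E) 1 V := .of_le (n := ω) le_top
  have hmulI : ContMDiff 𝓘(ℝ, E).tangent 𝓘(ℝ, E).tangent ∞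
      (fun w : TangentBundle 𝓘(ℝ, E) V =>
        (⟨w.1, Complex.I • modelVector w⟩ : TangentBundle 𝓘(ℝ, E) V)) :=
    contMDiff_const_smul_tangentBundle (I := 𝓘(ℝ, E)) (IK := 𝓘(ℂ, E)) rfl Complex.I
  have hβI := hβ.comp (hmulI.contMDiffOn (s := TotalSpace.proj ⁻¹' O)) fun _ hw => hw
  have hI : ContMDiff 𝓘(ℝ, F) 𝓘(ℝ, F) ∞ (fun z : F => Complex.I • z) :=
    (contDiff_const_smul Complex.I).contMDiff
  exact ((K.contMDiff.comp_contMDiffOn hβI).add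
    (hI.comp_contMDiffOn (K.contMDiff.comp_contMDiffOn hβ))).neg

end RealForm

section UnderlyingReal

variable {E : Type*} [NormedAddCommGroup E] [NormedSpace ℂ E]
  {F : Type*} [NormedAddCommGroup F] [NormedSpace ℂ F]
  {EP : Type*} [NormedAddCommGroup EP] [NormedSpace ℂ EP]
  {V : Type*} [TopologicalSpace V] [ChartedSpace E V]
  {G : Type*} [TopologicalSpace G] [ChartedSpace F G] [Group G]
  {P : Type*} [TopologicalSpace P] [ChartedSpace EP P]

/-- The differentiable principal bundle underlying a holomorphic one. -/
def PrincipalBundle.real (B : PrincipalBundle ω 𝓘(ℂ, E) 𝓘(ℂ, F) 𝓘(ℂ, EP) V G P) :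
    PrincipalBundle ∞ 𝓘(ℝ, E) 𝓘(ℝ, F) 𝓘(ℝ, EP) V G P where
  proj := B.proj
  act := B.act
  act_one := B.act_one
  act_mul := B.act_mul
  proj_act := B.proj_act
  contMDiff_proj := contMDiff_restrictScalars (IK := 𝓘(ℂ, EP)) (IK' := 𝓘(ℂ, E)) rfl rfl
    (B.contMDiff_proj.of_le le_top)
  contMDiff_act := contMDiff_restrictScalars (IK := 𝓘(ℂ, EP).prod 𝓘(ℂ, F)) (IK' := 𝓘(ℂ, EP))
    rfl rfl (B.contMDiff_act.of_le le_top)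
  locally_trivial x := by
    obtain ⟨e, hx, he, he', hact⟩ := B.locally_trivial x
    exact ⟨e, hx,
      contMDiffOn_restrictScalars (IK := 𝓘(ℂ, EP)) (IK' := 𝓘(ℂ, E).prod 𝓘(ℂ, F)) rfl rfl
        (he.of_le le_top),
      contMDiffOn_restrictScalars (IK := 𝓘(ℂ, E).prod 𝓘(ℂ, F)) (IK' := 𝓘(ℂ, EP)) rfl rfl
        (he'.of_le le_top), hact⟩

variable {B : PrincipalBundle ω 𝓘(ℂ, E) 𝓘(ℂ, F) 𝓘(ℂ, EP) V G P}
  {O : Set V} {s : V → P} {ψ : P → G}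

theorem PrincipalBundle.IsGauge.real (hg : B.IsGauge O s ψ) : B.real.IsGauge O s ψ where
  isOpen := hg.isOpen
  contMDiffOn_section := contMDiffOn_restrictScalars (IK := 𝓘(ℂ, E)) (IK' := 𝓘(ℂ, EP)) rfl rfl
    (hg.contMDiffOn_section.of_le le_top)
  contMDiffOn_coord := contMDiffOn_restrictScalars (IK := 𝓘(ℂ, EP)) (IK' := 𝓘(ℂ, F)) rfl rfl
    (hg.contMDiffOn_coord.of_le le_top)
  proj_section := hg.proj_section
  coord_act := hg.coord_act
  act_section_coord := hg.act_section_coord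

theorem PrincipalBundle.IsGauge.localConnection_I_smul [LieGroup 𝓘(ℂ, F) ω G]
    (hg : B.IsGauge O s ψ) {γ : V → E →L[ℝ] F}
    (hγ : ∀ y w, γ y (Complex.I • w) = Complex.I • γ y w) {p : P} (hp : B.proj p ∈ O) (v : EP) :
    B.real.localConnection ψ γ p (Complex.I • v) =
      Complex.I • B.real.localConnection ψ γ p v := by
  have : LieGroup 𝓘(ℂ, F) 1 G := .of_le (n := ω) le_top
  have hψ : MDifferentiableAt 𝓘(ℂ, EP) 𝓘(ℂ, F) ψ p :=
    (hg.contMDiffOn_coord.contMDiffAt ((hg.isOpen.preimage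
      B.contMDiff_proj.continuous).mem_nhds hp)).mdifferentiableAt (by simp)
  have hπ : MDifferentiableAt 𝓘(ℂ, EP) 𝓘(ℂ, E) B.real.proj p :=
    B.contMDiff_proj.mdifferentiableAt (by simp)
  have hlog := leftLogDeriv_smul (I := 𝓘(ℝ, EP)) (IK := 𝓘(ℂ, EP)) (IG := 𝓘(ℝ, F))
    (IGK := 𝓘(ℂ, F)) rfl rfl hψ Complex.I v
  have hproj := modelDeriv_smul_of_mdifferentiableAt (I := 𝓘(ℝ, EP)) (IK := 𝓘(ℂ, EP))
    (I' := 𝓘(ℝ, E)) (IK' := 𝓘(ℂ, E)) rfl rfl hπ Complex.I v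
  simp only [localConnection, add_apply, ContinuousLinearMap.comp_apply, smul_add, hlog, hproj, hγ]
  rw [modelAd_smul (IG := 𝓘(ℝ, F)) (IGK := 𝓘(ℂ, F)) rfl]

end UnderlyingReal

section ConnectionForm

variable {E : Type*} [NormedAddCommGroup E] [NormedSpace ℝ E]
  {F : Type*} [NormedAddCommGroup F] [NormedSpace ℝ F]
  {EP : Type*} [NormedAddCommGroup EP] [NormedSpace ℝ EP]
  {V : Type*} [TopologicalSpace V] [ChartedSpace E V]
  {G : Type*} [TopologicalSpace G] [ChartedSpace F G] [Group G]
  {P : Type*} [TopologicalSpace P] [ChartedSpace EP P] [IsManifold 𝓘(ℝ, EP) ∞ P]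

theorem isConnectionForm_iff_isConnectionFormOn_univ
    (B : PrincipalBundle ∞ 𝓘(ℝ, E) 𝓘(ℝ, F) 𝓘(ℝ, EP) V G P) (α : P → EP →L[ℝ] F) :
    IsConnectionForm (F := F) (EP := EP) B.act α ↔ B.IsConnectionFormOn Set.univ α := by
  have hfund : (∀ p (A : F), α (B.act p 1) (modelDeriv 𝓘(ℝ, F) 𝓘(ℝ, EP) (B.act p) 1 A) = A) ↔
      ∀ p (A : F), α p (modelDeriv 𝓘(ℝ, F) 𝓘(ℝ, EP) (B.act p) 1 A) = A := by
    simp only [B.act_one]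
  constructor
  · rintro ⟨hsmooth, hfundamental, hequivariant⟩
    exact ⟨ContMDiff.contMDiffOn hsmooth, fun p _ => hfund.1 hfundamental p,
      fun p _ g => hequivariant g p⟩
  · rintro ⟨hsmooth, hfundamental, hequivariant⟩
    exact ⟨contMDiffOn_univ.1 hsmooth, hfund.2 fun p => hfundamental p trivial,
      fun g p => hequivariant p trivial g⟩

end ConnectionForm

section CanonicalConnection

variable {E : Type*} [NormedAddCommGroup E] [NormedSpace ℂ E]
  {F : Type*} [NormedAddCommGroup F] [NormedSpace ℂ F]
  {EP : Type*} [NormedAddCommGroup EP] [NormedSpace ℂ EP]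
  {EU : Type*} [NormedAddCommGroup EU] [NormedSpace ℝ EU]
  {EQ : Type*} [NormedAddCommGroup EQ] [NormedSpace ℝ EQ]
  {V : Type*} [TopologicalSpace V] [ChartedSpace E V]
  {G : Type*} [TopologicalSpace G] [ChartedSpace F G] [Group G]
  {P : Type*} [TopologicalSpace P] [ChartedSpace EP P]
  {U : Type*} [TopologicalSpace U] [ChartedSpace EU U] [Group U]
  {Q : Type*} [TopologicalSpace Q] [ChartedSpace EQ Q]
  {BP : PrincipalBundle ω 𝓘(ℂ, E) 𝓘(ℂ, F) 𝓘(ℂ, EP) V G P}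
  {BQ : PrincipalBundle ∞ 𝓘(ℝ, E) 𝓘(ℝ, EU) 𝓘(ℝ, EQ) V U Q}
  {ι : U →* G} {f : Q → P} {O O' : Set V} {α α' : P → EP →L[ℝ] F}

theorem zeroOnePart_eq_zero_iff (α : P → EP →L[ℝ] F) :
    zeroOnePart (F := F) (G := G) (EP := EP) α = 0 ↔
      ∀ p v, α p (Complex.I • v) = Complex.I • α p v := by
  have happly : ∀ p (v : EP), (zeroOnePart (F := F) (G := G) (EP := EP) α p : EP →L[ℝ] F) v =
      (2⁻¹ : ℝ) • (α p v + Complex.I • α p (Complex.I • v)) := fun p v => rfl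
  have hsum : ∀ x y : F, (2⁻¹ : ℝ) • (x + Complex.I • y) = 0 ↔ y = Complex.I • x := fun x y => by
    rw [smul_eq_zero_iff_right (by norm_num), ← smul_right_inj Complex.I_ne_zero,
      smul_zero, smul_add, smul_smul, Complex.I_mul_I, neg_one_smul, ← sub_eq_add_neg,
      sub_eq_zero, eq_comm]
  simp only [← hsum, ← happly]
  exact ⟨fun h p v => by rw [h]; rfl, fun h => funext fun p => ContinuousLinearMap.ext (h p)⟩

/-- Over `O`, the form `α` is a connection form of type `(1, 0)` on `P` which restricts on the
reduction `f : Q → P` to a form with values in the Lie algebra of `U`. -/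
structure IsCanonicalConnectionOn [IsManifold 𝓘(ℂ, EP) ω P]
    (BP : PrincipalBundle ω 𝓘(ℂ, E) 𝓘(ℂ, F) 𝓘(ℂ, EP) V G P)
    (BQ : PrincipalBundle ∞ 𝓘(ℝ, E) 𝓘(ℝ, EU) 𝓘(ℝ, EQ) V U Q) (ι : U →* G) (f : Q → P)
    (O : Set V) (α : P → EP →L[ℝ] F) : Prop extends BP.real.IsConnectionFormOn O α where
  I_smul : ∀ p, BP.proj p ∈ O → ∀ v, α p (Complex.I • v) = Complex.I • α p v
  restrict : ∀ q, BQ.proj q ∈ O → ∀ v, α (f q) (modelDeriv 𝓘(ℝ, EQ) 𝓘(ℝ, EP) f q v) ∈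
    (modelDeriv 𝓘(ℝ, EU) 𝓘(ℝ, F) ι 1).range

theorem IsExtension.isCanonicalConnectionOn_univ [IsManifold 𝓘(ℂ, EP) ω P]
    {θ : LieValuedForm EU U EQ Q} {α : LieValuedForm F G EP P} (h : IsExtension BP ι f θ α)
    (h0 : zeroOnePart α = 0) : IsCanonicalConnectionOn BP BQ ι f Set.univ α where
  __ := (isConnectionForm_iff_isConnectionFormOn_univ BP.real α).1 h.isConnectionForm
  I_smul p _ := (zeroOnePart_eq_zero_iff (F := F) (G := G) (EP := EP) α).1 h0 p
  restrict q _ v := ⟨θ q v, (h.restrict q v).symm⟩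

namespace IsReduction

variable (hf : IsReduction BP BQ ι f)

include hf

theorem mdifferentiableAt (q : Q) : MDifferentiableAt 𝓘(ℝ, EQ) 𝓘(ℝ, EP) f q :=
  hf.smooth.mdifferentiableAt (by simp)

theorem modelDeriv_proj (q : Q) (w : EQ) :
    modelDeriv 𝓘(ℝ, EP) 𝓘(ℝ, E) BP.real.proj (f q) (modelDeriv 𝓘(ℝ, EQ) 𝓘(ℝ, EP) f q w) =
      modelDeriv 𝓘(ℝ, EQ) 𝓘(ℝ, E) BQ.proj q w := by
  have hcomp := modelDeriv_comp (BP.real.mdifferentiableAt_proj (f q)) (hf.mdifferentiableAt q)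
  rw [show (fun t => BP.real.proj (f t)) = BQ.proj from funext hf.proj_eq] at hcomp
  exact (DFunLike.congr_fun hcomp w).symm

theorem modelDeriv_act_fundamental [LieGroup 𝓘(ℝ, F) ∞ G]
    (hι : MDifferentiableAt 𝓘(ℝ, EU) 𝓘(ℝ, F) ι 1) (q : Q) (A : EU) :
    modelDeriv 𝓘(ℝ, EQ) 𝓘(ℝ, EP) f q (modelDeriv 𝓘(ℝ, EU) 𝓘(ℝ, EQ) (BQ.act q) 1 A) =
      modelDeriv 𝓘(ℝ, F) 𝓘(ℝ, EP) (BP.act (f q)) 1 (modelDeriv 𝓘(ℝ, EU) 𝓘(ℝ, F) ι 1 A) := by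
  have hleft := modelDeriv_comp_of_eq (hf.mdifferentiableAt q) (BQ.mdifferentiableAt_act_left q 1)
    (BQ.act_one q)
  have hright := modelDeriv_comp_of_eq (BP.real.mdifferentiableAt_act_left (f q) 1) hι (map_one ι)
  simp only [hf.equivariant] at hleft
  exact DFunLike.congr_fun (hleft.symm.trans hright) A

theorem modelDeriv_act_right (q : Q) (u : U) (v : EQ) :
    modelDeriv 𝓘(ℝ, EQ) 𝓘(ℝ, EP) f (BQ.act q u)
        (modelDeriv 𝓘(ℝ, EQ) 𝓘(ℝ, EQ) (fun q => BQ.act q u) q v) =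
      modelDeriv 𝓘(ℝ, EP) 𝓘(ℝ, EP) (fun p => BP.act p (ι u)) (f q)
        (modelDeriv 𝓘(ℝ, EQ) 𝓘(ℝ, EP) f q v) := by
  have hleft := modelDeriv_comp (f := fun q => BQ.act q u) (hf.mdifferentiableAt (BQ.act q u))
    (BQ.mdifferentiableAt_act_right q u)
  have hright := modelDeriv_comp (BP.real.mdifferentiableAt_act_right (f q) (ι u))
    (hf.mdifferentiableAt q)
  simp only [hf.equivariant] at hleft
  exact DFunLike.congr_fun (hleft.symm.trans hright) v

theorem exists_fundamental_add_modelDeriv_eq [LieGroup 𝓘(ℝ, F) 1 G] (q : Q) (v : EP) :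
    ∃ A w, modelDeriv 𝓘(ℝ, F) 𝓘(ℝ, EP) (BP.act (f q)) 1 A +
      modelDeriv 𝓘(ℝ, EQ) 𝓘(ℝ, EP) f q w = v := by
  obtain ⟨w, hw⟩ := BQ.surjective_modelDeriv_proj q
    (modelDeriv 𝓘(ℝ, EP) 𝓘(ℝ, E) BP.real.proj (f q) v)
  have hvertical : modelDeriv 𝓘(ℝ, EP) 𝓘(ℝ, E) BP.real.proj (f q)
      (v - modelDeriv 𝓘(ℝ, EQ) 𝓘(ℝ, EP) f q w) = 0 := by
    rw [map_sub, hf.modelDeriv_proj, hw, sub_self]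
  obtain ⟨A, hA⟩ := BP.real.exists_fundamental_eq hvertical
  exact ⟨A, w, eq_sub_iff_add_eq.1 hA⟩

theorem isConnectionFormOn_of_restrict [IsManifold 𝓘(ℂ, EP) ω P] [IsManifold 𝓘(ℝ, EQ) ∞ Q]
    [LieGroup 𝓘(ℝ, F) ∞ G] [LieGroup 𝓘(ℝ, EU) ∞ U]
    (hι : MDifferentiableAt 𝓘(ℝ, EU) 𝓘(ℝ, F) ι 1) (hα : BP.real.IsConnectionFormOn O α)
    {re : F →L[ℝ] EU} (hre : ∀ u, re (modelDeriv 𝓘(ℝ, EU) 𝓘(ℝ, F) ι 1 u) = u)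
    {θ : Q → EQ →L[ℝ] EU} (hθ : ∀ q, BQ.proj q ∈ O → ∀ v,
      modelDeriv 𝓘(ℝ, EU) 𝓘(ℝ, F) ι 1 (θ q v) =
        α (f q) (modelDeriv 𝓘(ℝ, EQ) 𝓘(ℝ, EP) f q v)) :
    BQ.IsConnectionFormOn O θ := by
  have hproj : ∀ {q}, BQ.proj q ∈ O → BP.real.proj (f q) ∈ O := fun {q} hq =>
    (hf.proj_eq q).symm ▸ hq
  have hθ_eq : ∀ q, BQ.proj q ∈ O → ∀ v,
      θ q v = re (α (f q) (modelDeriv 𝓘(ℝ, EQ) 𝓘(ℝ, EP) f q v)) := fun q hq v => by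
    rw [← hθ q hq, hre]
  refine ⟨?_, fun q hq A => ?_, fun q hq u v => ?_⟩
  · have htangent := contMDiffOn_univ.1
      (contMDiffOn_tangentMap_of_isOpen isOpen_univ hf.smooth.contMDiffOn)
    refine (re.contMDiff.comp_contMDiffOn (hα.contMDiffOn.comp htangent.contMDiffOn
      fun v hv => hproj hv)).congr fun v hv => hθ_eq v.1 hv (modelVector v)
  · rw [hθ_eq q hq, hf.modelDeriv_act_fundamental hι]
    exact (congrArg re (hα.fundamental (f q) (hproj hq) _)).trans (hre A)
  · have hAd : ∀ A, modelAd 𝓘(ℝ, F) (ι u)⁻¹ (modelDeriv 𝓘(ℝ, EU) 𝓘(ℝ, F) ι 1 A) =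
        modelDeriv 𝓘(ℝ, EU) 𝓘(ℝ, F) ι 1 (modelAd 𝓘(ℝ, EU) u⁻¹ A) := fun A => by
      rw [← map_inv]
      exact DFunLike.congr_fun (modelAd_map hι u⁻¹) A
    rw [hθ_eq _ ((BQ.proj_act q u).symm ▸ hq), hf.modelDeriv_act_right, hf.equivariant]
    refine (congrArg re (hα.equivariant (f q) (hproj hq) (ι u) _)).trans ?_
    rw [← hθ q hq, hAd, hre]

end IsReduction

namespace IsCanonicalConnectionOn

variable [IsManifold 𝓘(ℂ, EP) ω P] [LieGroup 𝓘(ℂ, F) ω G]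

theorem sub_apply_mem_range (hf : IsReduction BP BQ ι f)
    (h : IsCanonicalConnectionOn BP BQ ι f O α) (h' : IsCanonicalConnectionOn BP BQ ι f O' α')
    {q : Q} (hq : BQ.proj q ∈ O) (hq' : BQ.proj q ∈ O') (v : EP) :
    α (f q) v - α' (f q) v ∈ (modelDeriv 𝓘(ℝ, EU) 𝓘(ℝ, F) ι 1).range := by
  have : LieGroup 𝓘(ℝ, F) 1 G := .of_le (n := ∞) (by simp)
  obtain ⟨A, w, rfl⟩ := hf.exists_fundamental_add_modelDeriv_eq q v
  have hA : α (f q) (modelDeriv 𝓘(ℝ, F) 𝓘(ℝ, EP) (BP.act (f q)) 1 A) = A :=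
    h.fundamental (f q) ((hf.proj_eq q).symm ▸ hq) A
  have hA' : α' (f q) (modelDeriv 𝓘(ℝ, F) 𝓘(ℝ, EP) (BP.act (f q)) 1 A) = A :=
    h'.fundamental (f q) ((hf.proj_eq q).symm ▸ hq') A
  rw [map_add, map_add, hA, hA', add_sub_add_left_eq_sub]
  exact Submodule.sub_mem _ (h.restrict q hq w) (h'.restrict q hq' w)

theorem eq_on_reduction (hreal : IsRealForm EU F ι) (hf : IsReduction BP BQ ι f)
    (h : IsCanonicalConnectionOn BP BQ ι f O α) (h' : IsCanonicalConnectionOn BP BQ ι f O' α')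
    {q : Q} (hq : BQ.proj q ∈ O) (hq' : BQ.proj q ∈ O') : α (f q) = α' (f q) := by
  ext v
  have hmem := h.sub_apply_mem_range hf h' hq hq' (Complex.I • v)
  rw [h.I_smul _ ((hf.proj_eq q).symm ▸ hq), h'.I_smul _ ((hf.proj_eq q).symm ▸ hq'),
    ← smul_sub] at hmem
  have hzero : Complex.I • (α (f q) v - α' (f q) v) = 0 :=
    Submodule.disjoint_def.1 hreal.disjoint _ hmem
      ⟨_, h.sub_apply_mem_range hf h' hq hq' v, rfl⟩
  exact sub_eq_zero.1 ((smul_eq_zero.1 hzero).resolve_left Complex.I_ne_zero)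

theorem eq_of_mem (hreal : IsRealForm EU F ι) (hf : IsReduction BP BQ ι f)
    (h : IsCanonicalConnectionOn BP BQ ι f O α) (h' : IsCanonicalConnectionOn BP BQ ι f O' α')
    {p : P} (hp : BP.proj p ∈ O) (hp' : BP.proj p ∈ O') : α p = α' p := by
  obtain ⟨q, hq⟩ := BQ.surjective_proj (BP.proj p)
  obtain ⟨g, rfl⟩ := BP.exists_act_eq ((hf.proj_eq q).trans hq)
  have hfq := (hf.proj_eq q).trans hq
  exact h.eq_act h'.toIsConnectionFormOn (hfq ▸ hp) (hfq ▸ hp')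
    (h.eq_on_reduction hreal hf h' (hq ▸ hp) (hq ▸ hp')) g

end IsCanonicalConnectionOn

section LocalExistence

/-- The `(1, 0)`-form `γ` on the base for which the gauge transform `h⁻¹ dh + Ad(h⁻¹) γ` of `γ` by
`h` is `𝔲`-valued, where `K z ∈ 𝔲` is the imaginary part of `z = re z + i K z` in a real form
`𝔤 = 𝔲 ⊕ i𝔲`. -/
def canonicalLocalForm (K : F →L[ℝ] F) (h : V → G) (y : V) : E →L[ℝ] F :=
  (modelAd 𝓘(ℝ, F) (h y)).comp (realFormCorrection K (leftLogDeriv 𝓘(ℝ, E) 𝓘(ℝ, F) h y))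

namespace IsReduction

variable {s : V → Q} {τ : Q → U} {σ : V → P} {ψ : P → G}

theorem contMDiffOn_coord_section (hf : IsReduction BP BQ ι f) (hψ : BP.IsGauge O σ ψ)
    (hτ : BQ.IsGauge O s τ) : ContMDiffOn 𝓘(ℝ, E) 𝓘(ℝ, F) ∞ (fun y => ψ (f (s y))) O :=
  hψ.real.contMDiffOn_coord.comp (hf.smooth.comp_contMDiffOn hτ.contMDiffOn_section) fun y hy => by
    change BP.proj (f (s y)) ∈ O
    rwa [hf.proj_eq, hτ.proj_section y hy]

theorem coord_apply_eq_mul (hf : IsReduction BP BQ ι f) (hψ : BP.IsGauge O σ ψ)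
    (hτ : BQ.IsGauge O s τ) {q : Q} (hq : BQ.proj q ∈ O) :
    ψ (f q) = ψ (f (s (BQ.proj q))) * ι (τ q) := by
  conv_lhs => rw [← hτ.act_section_coord q hq, hf.equivariant]
  refine hψ.coord_act _ ?_ _
  rwa [hf.proj_eq, hτ.proj_section _ hq]

end IsReduction

variable [LieGroup 𝓘(ℂ, F) ω G]

theorem canonicalLocalForm_I_smul (K : F →L[ℝ] F) (h : V → G) (y : V) (w : E) :
    canonicalLocalForm K h y (Complex.I • w) = Complex.I • canonicalLocalForm K h y w := by
  have : LieGroup 𝓘(ℂ, F) 1 G := .of_le (n := ω) le_top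
  simp only [canonicalLocalForm, ContinuousLinearMap.comp_apply, realFormCorrection_I_smul]
  exact modelAd_smul (IG := 𝓘(ℝ, F)) (IGK := 𝓘(ℂ, F)) rfl _ _ _

theorem contMDiffOn_canonicalLocalForm [IsManifold 𝓘(ℂ, E) ω V] (K : F →L[ℝ] F) {h : V → G}
    (hO : IsOpen O) (hh : ContMDiffOn 𝓘(ℝ, E) 𝓘(ℝ, F) ∞ h O) :
    ContMDiffOn 𝓘(ℝ, E).tangent 𝓘(ℝ, F) ∞
      (fun w : TangentBundle 𝓘(ℝ, E) V => canonicalLocalForm K h w.1 (modelVector w))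
      (TotalSpace.proj ⁻¹' O) := by
  have hproj : ContMDiff 𝓘(ℝ, E).tangent 𝓘(ℝ, E) ∞
      (TotalSpace.proj : TangentBundle 𝓘(ℝ, E) V → V) :=
    Bundle.contMDiff_proj (TangentSpace 𝓘(ℝ, E))
  have hhproj := hh.comp (hproj.contMDiffOn (s := TotalSpace.proj ⁻¹' O)) fun _ hw => hw
  exact contMDiff_modelAd.comp_contMDiffOn
    (hhproj.prodMk (contMDiffOn_realFormCorrection K (contMDiffOn_leftLogDeriv hO hh)))

theorem leftLogDeriv_add_modelAd_canonicalLocalForm_mem_range {L : EU →L[ℝ] F}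
    {re im : F →L[ℝ] EU} (hre_im : ∀ z, L (re z) + Complex.I • L (im z) = z) (h : V → G) (y : V)
    (w : E) : leftLogDeriv 𝓘(ℝ, E) 𝓘(ℝ, F) h y w +
      modelAd 𝓘(ℝ, F) (h y)⁻¹ (canonicalLocalForm (L.comp im) h y w) ∈ L.range := by
  have : LieGroup 𝓘(ℝ, F) 1 G := .of_le (n := ∞) (by simp)
  have hcancel : (modelAd 𝓘(ℝ, F) (h y)⁻¹).comp (modelAd 𝓘(ℝ, F) (h y)) =
      ContinuousLinearMap.id ℝ F := by
    rw [← modelAd_mul, inv_mul_cancel, modelAd_one]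
  rw [canonicalLocalForm, ContinuousLinearMap.comp_apply, ← ContinuousLinearMap.comp_apply,
    hcancel]
  exact add_realFormCorrection_mem_range hre_im _ w

namespace IsReduction

variable {s : V → Q} {τ : Q → U} {σ : V → P} {ψ : P → G}

theorem localConnection_canonicalLocalForm_mem_range [LieGroup 𝓘(ℝ, EU) 1 U]
    (hf : IsReduction BP BQ ι f) (hι : MDifferentiable 𝓘(ℝ, EU) 𝓘(ℝ, F) ι)
    {re im : F →L[ℝ] EU} (hre_im : ∀ z, modelDeriv 𝓘(ℝ, EU) 𝓘(ℝ, F) ι 1 (re z) +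
      Complex.I • modelDeriv 𝓘(ℝ, EU) 𝓘(ℝ, F) ι 1 (im z) = z)
    (hψ : BP.IsGauge O σ ψ) (hτ : BQ.IsGauge O s τ) {q : Q} (hq : BQ.proj q ∈ O) (v : EQ) :
    BP.real.localConnection ψ (canonicalLocalForm
        ((modelDeriv 𝓘(ℝ, EU) 𝓘(ℝ, F) ι 1).comp im) fun y => ψ (f (s y)))
      (f q) (modelDeriv 𝓘(ℝ, EQ) 𝓘(ℝ, EP) f q v) ∈ (modelDeriv 𝓘(ℝ, EU) 𝓘(ℝ, F) ι 1).range := by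
  have : LieGroup 𝓘(ℝ, F) 1 G := .of_le (n := ∞) (by simp)
  have hdψ : MDifferentiableAt 𝓘(ℝ, EP) 𝓘(ℝ, F) ψ (f q) :=
    hψ.real.mdifferentiableAt_coord ((hf.proj_eq q).symm ▸ hq)
  have hdτ := hτ.mdifferentiableAt_coord hq
  have hdh : MDifferentiableAt 𝓘(ℝ, E) 𝓘(ℝ, F) (fun y => ψ (f (s y))) (BQ.proj q) :=
    ((hf.contMDiffOn_coord_section hψ hτ).contMDiffAt
      (hψ.isOpen.mem_nhds hq)).mdifferentiableAt (by simp)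
  have hdproj := BQ.mdifferentiableAt_proj q
  rw [PrincipalBundle.localConnection_comp_of_coord_eq_mul
    (a := fun t => ψ (f (s (BQ.proj t)))) (b := fun t => ι (τ t)) hdψ
    (hf.mdifferentiableAt q) (hdh.comp q hdproj) ((hι _).comp q hdτ)
    (by filter_upwards [hτ.eventually_proj_mem hq] with t ht using hf.coord_apply_eq_mul hψ hτ ht)
    hf.proj_eq]
  refine Submodule.add_mem _ ?_ ?_
  · rw [leftLogDeriv_map (hι 1) hdτ]
    exact ⟨_, rfl⟩
  · obtain ⟨u, hu⟩ := leftLogDeriv_add_modelAd_canonicalLocalForm_mem_range hre_im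
      (fun y => ψ (f (s y))) (BQ.proj q) (modelDeriv 𝓘(ℝ, EQ) 𝓘(ℝ, E) BQ.proj q v)
    refine ⟨modelAd 𝓘(ℝ, EU) (τ q)⁻¹ u, ?_⟩
    have hAd := DFunLike.congr_fun (modelAd_map (IG := 𝓘(ℝ, F)) (hι 1) (τ q)⁻¹) u
    rw [map_inv] at hAd
    refine hAd.symm.trans (congrArg (modelAd 𝓘(ℝ, F) (ι (τ q))⁻¹) (hu.trans ?_))
    rw [leftLogDeriv_comp hdh hdproj]
    rfl

theorem isCanonicalConnectionOn_localConnection [IsManifold 𝓘(ℂ, E) ω V] [IsManifold 𝓘(ℂ, EP) ω P]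
    [LieGroup 𝓘(ℝ, EU) 1 U] (hf : IsReduction BP BQ ι f) (hι : MDifferentiable 𝓘(ℝ, EU) 𝓘(ℝ, F) ι)
    {re im : F →L[ℝ] EU} (hre_im : ∀ z, modelDeriv 𝓘(ℝ, EU) 𝓘(ℝ, F) ι 1 (re z) +
      Complex.I • modelDeriv 𝓘(ℝ, EU) 𝓘(ℝ, F) ι 1 (im z) = z)
    (hψ : BP.IsGauge O σ ψ) (hτ : BQ.IsGauge O s τ) :
    IsCanonicalConnectionOn BP BQ ι f O (BP.real.localConnection ψ (canonicalLocalForm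
      ((modelDeriv 𝓘(ℝ, EU) 𝓘(ℝ, F) ι 1).comp im) fun y => ψ (f (s y)))) where
  __ := hψ.real.isConnectionFormOn_localConnection
    (contMDiffOn_canonicalLocalForm _ hψ.isOpen (hf.contMDiffOn_coord_section hψ hτ))
  I_smul _ hp := hψ.localConnection_I_smul (canonicalLocalForm_I_smul _ _) hp
  restrict _ hq := hf.localConnection_canonicalLocalForm_mem_range hι hre_im hψ hτ hq

theorem exists_isCanonicalConnectionOn_nhds [IsManifold 𝓘(ℂ, E) ω V] [IsManifold 𝓘(ℂ, EP) ω P]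
    [LieGroup 𝓘(ℝ, EU) 1 U] (hf : IsReduction BP BQ ι f) (hι : MDifferentiable 𝓘(ℝ, EU) 𝓘(ℝ, F) ι)
    {re im : F →L[ℝ] EU} (hre_im : ∀ z, modelDeriv 𝓘(ℝ, EU) 𝓘(ℝ, F) ι 1 (re z) +
      Complex.I • modelDeriv 𝓘(ℝ, EU) 𝓘(ℝ, F) ι 1 (im z) = z) (x : V) :
    ∃ O, IsOpen O ∧ x ∈ O ∧ ∃ α, IsCanonicalConnectionOn BP BQ ι f O α := by
  obtain ⟨O₁, σ, ψ, hx₁, hψ⟩ := BP.exists_isGauge x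
  obtain ⟨O₂, s, τ, hx₂, hτ⟩ := BQ.exists_isGauge x
  have hO := hψ.isOpen.inter hτ.isOpen
  exact ⟨O₁ ∩ O₂, hO, ⟨hx₁, hx₂⟩, _, hf.isCanonicalConnectionOn_localConnection hι hre_im
    (hψ.mono hO Set.inter_subset_left) (hτ.mono hO Set.inter_subset_right)⟩

end IsReduction

end LocalExistence

theorem IsCanonicalConnectionOn.glue [IsManifold 𝓘(ℂ, EP) ω P] [LieGroup 𝓘(ℂ, F) ω G]
    (hreal : IsRealForm EU F ι) (hf : IsReduction BP BQ ι f) {O : V → Set V}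
    (hO : ∀ x, IsOpen (O x)) (hx : ∀ x, x ∈ O x) {α : V → P → EP →L[ℝ] F}
    (hα : ∀ x, IsCanonicalConnectionOn BP BQ ι f (O x) (α x)) :
    IsCanonicalConnectionOn BP BQ ι f Set.univ fun p => α (BP.proj p) p where
  contMDiffOn v₀ _ := by
    have hnhds : TotalSpace.proj ⁻¹' (BP.proj ⁻¹' O (BP.proj v₀.1)) ∈ 𝓝 v₀ :=
      ((BP.real.isOpen_preimage_proj (hO _)).preimage
        (FiberBundle.continuous_proj EP (TangentSpace 𝓘(ℝ, EP)))).mem_nhds (hx _)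
    refine (((hα (BP.proj v₀.1)).contMDiffOn.contMDiffAt hnhds).congr_of_eventuallyEq
      ?_).contMDiffWithinAt
    filter_upwards [hnhds] with v hv
    exact DFunLike.congr_fun ((hα _).eq_of_mem hreal hf (hα _) (hx _) hv) (modelVector v)
  fundamental p _ := (hα _).fundamental p (hx _)
  equivariant p _ g v := by
    change α (BP.proj (BP.act p g)) (BP.act p g) _ = _
    rw [BP.proj_act]
    exact (hα _).equivariant p (hx _) g v
  I_smul p _ := (hα _).I_smul p (hx _)
  restrict q _ := (hα _).restrict q (hf.proj_eq q ▸ hx _)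

theorem IsReduction.exists_isCanonicalConnectionOn_univ [LieGroup 𝓘(ℂ, F) ω G]
    [IsManifold 𝓘(ℂ, E) ω V] [IsManifold 𝓘(ℂ, EP) ω P] [LieGroup 𝓘(ℝ, EU) 1 U]
    (hreal : IsRealForm EU F ι) (hf : IsReduction BP BQ ι f)
    (hι : MDifferentiable 𝓘(ℝ, EU) 𝓘(ℝ, F) ι)
    {re im : F →L[ℝ] EU} (hre_im : ∀ z, modelDeriv 𝓘(ℝ, EU) 𝓘(ℝ, F) ι 1 (re z) +
      Complex.I • modelDeriv 𝓘(ℝ, EU) 𝓘(ℝ, F) ι 1 (im z) = z) :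
    ∃ α, IsCanonicalConnectionOn BP BQ ι f Set.univ α := by
  choose O hO hx α hα using hf.exists_isCanonicalConnectionOn_nhds hι hre_im
  exact ⟨_, IsCanonicalConnectionOn.glue hreal hf hO hx hα⟩

theorem IsCanonicalConnectionOn.exists_isExtension [IsManifold 𝓘(ℂ, EP) ω P]
    [IsManifold 𝓘(ℝ, EQ) ∞ Q] [LieGroup 𝓘(ℂ, F) ω G] [LieGroup 𝓘(ℝ, EU) ∞ U]
    (h : IsCanonicalConnectionOn BP BQ ι f Set.univ α) (hf : IsReduction BP BQ ι f)
    (hι : MDifferentiableAt 𝓘(ℝ, EU) 𝓘(ℝ, F) ι 1)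
    {re : F →L[ℝ] EU} (hre : ∀ u, re (modelDeriv 𝓘(ℝ, EU) 𝓘(ℝ, F) ι 1 u) = u) :
    ∃ θ : LieValuedForm EU U EQ Q, IsConnectionForm BQ.act θ ∧
      IsExtension (G := G) BP ι f θ α := by
  let θ : Q → EQ →L[ℝ] EU := fun q => re.comp ((α (f q)).comp (modelDeriv 𝓘(ℝ, EQ) 𝓘(ℝ, EP) f q))
  have hθ : ∀ q v, modelDeriv 𝓘(ℝ, EU) 𝓘(ℝ, F) ι 1 (θ q v) =
      α (f q) (modelDeriv 𝓘(ℝ, EQ) 𝓘(ℝ, EP) f q v) := fun q v => by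
    obtain ⟨u, hu⟩ := h.restrict q trivial v
    exact (congrArg _ ((congrArg re hu.symm).trans (hre u))).trans hu
  exact ⟨θ, (isConnectionForm_iff_isConnectionFormOn_univ BQ θ).2
      (hf.isConnectionFormOn_of_restrict hι h.toIsConnectionFormOn hre fun q _ => hθ q),
    (isConnectionForm_iff_isConnectionFormOn_univ BP.real α).2 h.toIsConnectionFormOn,
    fun q v => (hθ q v).symm⟩

theorem IsExtension.eq_of_zeroOnePart_eq_zero [IsManifold 𝓘(ℂ, EP) ω P] [LieGroup 𝓘(ℂ, F) ω G]
    (himm : Function.Injective (lieAlgebraMap EU F ι)) (hreal : IsRealForm EU F ι)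
    (hf : IsReduction BP BQ ι f) {θ θ' : LieValuedForm EU U EQ Q} {α α' : LieValuedForm F G EP P}
    (h : IsExtension BP ι f θ α) (h' : IsExtension BP ι f θ' α') (h0 : zeroOnePart α = 0)
    (h0' : zeroOnePart α' = 0) : θ = θ' := by
  have hα := h.isCanonicalConnectionOn_univ (BQ := BQ) h0
  have hα' := h'.isCanonicalConnectionOn_univ (BQ := BQ) h0'
  funext q
  refine ContinuousLinearMap.ext fun v => himm ?_
  rw [← h.restrict, ← h'.restrict,
    hα.eq_of_mem hreal hf hα' (p := f q) trivial trivial]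

end CanonicalConnection

end

theorem mainTheorem5_general
    {E : Type*} [NormedAddCommGroup E] [NormedSpace ℂ E]
    {F : Type*} [NormedAddCommGroup F] [NormedSpace ℂ F] [CompleteSpace F]
    {EP : Type*} [NormedAddCommGroup EP] [NormedSpace ℂ EP]
    {EU : Type*} [NormedAddCommGroup EU] [NormedSpace ℝ EU] [CompleteSpace EU]
    {EQ : Type*} [NormedAddCommGroup EQ] [NormedSpace ℝ EQ]
    {V : Type*} [TopologicalSpace V] [ChartedSpace E V] [IsManifold 𝓘(ℂ, E) ω V]
    {G : Type*} [TopologicalSpace G] [ChartedSpace F G] [Group G] [LieGroup 𝓘(ℂ, F) ω G]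
    {P : Type*} [TopologicalSpace P] [ChartedSpace EP P] [IsManifold 𝓘(ℂ, EP) ω P]
    {U : Type*} [TopologicalSpace U] [ChartedSpace EU U] [Group U] [LieGroup 𝓘(ℝ, EU) ∞ U]
    {Q : Type*} [TopologicalSpace Q] [ChartedSpace EQ Q] [IsManifold 𝓘(ℝ, EQ) ∞ Q]
    (BP : PrincipalBundle ω 𝓘(ℂ, E) 𝓘(ℂ, F) 𝓘(ℂ, EP) V G P)
    (BQ : PrincipalBundle ∞ 𝓘(ℝ, E) 𝓘(ℝ, EU) 𝓘(ℝ, EQ) V U Q)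
    (ι : U →* G) (hι : ContMDiff 𝓘(ℝ, EU) 𝓘(ℝ, F) ∞ ι)
    (himm : Function.Injective (lieAlgebraMap EU F ι)) (hreal : IsRealForm EU F ι)
    (f : Q → P) (hf : IsReduction BP BQ ι f) :
    ∃! θ : LieValuedForm EU U EQ Q, IsConnectionForm BQ.act θ ∧
      ∃ α : LieValuedForm F G EP P, IsExtension BP ι f θ α ∧ zeroOnePart α = 0 := by
  have hdι : MDifferentiable 𝓘(ℝ, EU) 𝓘(ℝ, F) ι := hι.mdifferentiable (by simp)
  obtain ⟨re, im, hre_im, hre⟩ :=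
    exists_re_im_of_isCompl (L := modelDeriv 𝓘(ℝ, EU) 𝓘(ℝ, F) ι 1) himm hreal
  have : LieGroup 𝓘(ℝ, EU) 1 U := .of_le (n := ∞) (by simp)
  obtain ⟨α, hα⟩ := hf.exists_isCanonicalConnectionOn_univ hreal hdι hre_im
  obtain ⟨θ, hθ, hext⟩ := hα.exists_isExtension hf (hdι 1) hre
  have hzero : zeroOnePart (F := F) (G := G) (EP := EP) α = 0 :=
    (zeroOnePart_eq_zero_iff α).2 fun p => hα.I_smul p trivial
  refine ⟨θ, ⟨hθ, α, hext, hzero⟩, ?_⟩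
  rintro θ' ⟨-, α', hext', hzero'⟩
  exact hext'.eq_of_zeroOnePart_eq_zero himm hreal hf hext hzero' hzero

theorem mainTheorem5
    {E : Type*} [NormedAddCommGroup E] [NormedSpace ℂ E] [FiniteDimensional ℂ E]
    {F : Type*} [NormedAddCommGroup F] [NormedSpace ℂ F] [FiniteDimensional ℂ F]
    {EP : Type*} [NormedAddCommGroup EP] [NormedSpace ℂ EP] [FiniteDimensional ℂ EP]
    {EU : Type*} [NormedAddCommGroup EU] [NormedSpace ℝ EU] [FiniteDimensional ℝ EU]
    {EQ : Type*} [NormedAddCommGroup EQ] [NormedSpace ℝ EQ] [FiniteDimensional ℝ EQ]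
    {V : Type*} [TopologicalSpace V] [T2Space V] [ChartedSpace E V] [IsManifold 𝓘(ℂ, E) ω V]
    {G : Type*} [TopologicalSpace G] [ChartedSpace F G] [Group G] [LieGroup 𝓘(ℂ, F) ω G]
    {P : Type*} [TopologicalSpace P] [ChartedSpace EP P] [IsManifold 𝓘(ℂ, EP) ω P]
    {U : Type*} [TopologicalSpace U] [ChartedSpace EU U] [Group U] [LieGroup 𝓘(ℝ, EU) ∞ U]
    {Q : Type*} [TopologicalSpace Q] [ChartedSpace EQ Q] [IsManifold 𝓘(ℝ, EQ) ∞ Q]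
    (BP : PrincipalBundle ω 𝓘(ℂ, E) 𝓘(ℂ, F) 𝓘(ℂ, EP) V G P)
    (BQ : PrincipalBundle ∞ 𝓘(ℝ, E) 𝓘(ℝ, EU) 𝓘(ℝ, EQ) V U Q)
    (ι : U →* G) (hι : IsLieSubgroup EU F ι) (hreal : IsRealForm EU F ι)
    (f : Q → P) (hf : IsReduction BP BQ ι f) :
    ∃! θ : LieValuedForm EU U EQ Q, IsConnectionForm BQ.act θ ∧
      ∃ α : LieValuedForm F G EP P, IsExtension BP ι f θ α ∧ zeroOnePart α = 0 := by
  have := FiniteDimensional.complete ℂ F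
  have := FiniteDimensional.complete ℝ EU
  exact mainTheorem5_general BP BQ ι hι.smooth hι.immersive hreal f hf
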